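/- Let $R$ be a commutative ring and $\underline S=(S_1,\dots,S_d)$ a $d$-tuple of multiplicative systems (submonoids of $(R,\cdot)$). For $n\in\{0,1,2,\dots,\infty\}$ let $\mathcal P(R,n)$ be the category of bounded chain complexes $P_\bullet$ of finitely generated projective $R$-modules with $P_i=0$ for $i\notin[0,n]$. Call $P_\bullet$ $\underline S$-exact if $S_i^{-1}P_\bullet$ is exact for every $i$. Let $K(R\text{ on }\underline S,n)$ be the free abelian group on isomorphism classes of $\underline S$-exact complexes in $\mathcal P(R,n)$ modulo the relations (1) $[P]=[P']+[P'']$ for each short exact sequence $0\to P'\to P\to P''\to 0$ of such complexes, and (2) $[P]=0$ if $H_*(P)=0$. For $\underline s=(s_1,\dots,s_d)\in R^d$ let $T_{\underline s}$ be the free (non-commutative) differential graded $R$-algebra on generators $e_1,\dots,e_d$ of degree $1$ with $d(e_i)=s_i$. Let $\mathcal P(T_{\underline s},n)$ be the category of left dg-modules over $T_{\underline s}$ whose underlying complex lies in $\mathcal P(R,n)$, and let $G(T_{\underline s},n)$ be the free abelian group on isomorphism classes of its objects modulo the relations (1) and (2), with short exact sequences taken in $\mathcal P(T_{\underline s},n)$.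 Write $\underline s\,\underline t=(s_it_i)_i$ and $\underline s^2=\underline s\,\underline s$. Denote by $j\colon G(T_{\underline s},n)\to G(T_{\underline s\,\underline t},n)$ the map given by restriction of scalars along $T_{\underline s\,\underline t}\to T_{\underline s}$, $e_i\mapsto t_ie_i$, and by $i\colon G(T_{\underline s},n)\to G(T_{\underline s},n+1)$ the map induced by inclusion. Let $tS_i$ be the category whose objects are the elements of $S_i$ and whose morphisms $s\to t$ are the $x\in S_i$ with $sx=t$; the maps $j$ make $\underline s\mapsto G(T_{\underline s},n)$ a functor on $tS_1\times\cdots\times tS_d$. **Theorem.** For $d\le k\le n\le\infty$, the map $K(R\text{ on }\underline S,k)\to K(R\text{ on }\underline S,n)$ induced by inclusion is an isomorphism. Moreover (with $\infty+1=\infty$): (a) for every $\underline s\in R^d$ and $d\le n\le\infty$ there is a homomorphism $\mathcal W\colon G(T_{\underline s},n+1)\to G(T_{\underline s^2},n)$ with $\mathcal W i=j$ on $G(T_{\underline s},n)$ and $i\mathcal W=j$ on $G(T_{\underline s},n+1)$; (b) for $d\le n\le\infty$ forgetting the $T_{\underline s}$-module structure induces an isomorphism $\operatorname{colim}_{\underline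 s\in tS_1\times\cdots\times tS_d}G(T_{\underline s},n)\to K(R\text{ on }\underline S,n)$; (c) for $d\le n\le\infty$ the map $K(R\text{ on }\underline S,n)\to K(R\text{ on }\underline S,n+1)$ is an isomorphism. -/

import Mathlib

open CategoryTheory CategoryTheory.Limits

universe w v u

/-! ### Grothendieck groups of categories of chain complexes with extra structure -/

namespace GrothGrp

variable {R : Type u} [CommRing R]

section

variable {C : Type w} [Category.{v} C] (U : C ⥤ ChainComplex (ModuleCat.{u} R) ℕ)

/-- `0 ⟶ X' ⟶ X ⟶ X'' ⟶ 0` can be made into a short exact sequence: there are morphisms of `C`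
whose underlying chain maps form a short exact sequence of chain complexes. -/
def HasShortExact (X' X X'' : C) : Prop :=
  ∃ (f : X' ⟶ X) (g : X ⟶ X'') (h : U.map f ≫ U.map g = 0),
    (ShortComplex.mk (U.map f) (U.map g) h).ShortExact

variable (P : ObjectProperty C)

/-- The free abelian group on the isomorphism classes of objects of `C` with the property `P`. -/
abbrev FreeGrp : Type w :=
  FreeAbelianGroup (Quotient (isIsomorphicSetoid P.FullSubcategory))

variable {P} in
/-- The generator given by the isomorphism class of `X`. -/
def gen (X : P.FullSubcategory) : FreeGrp P :=
  FreeAbelianGroup.of (Quotient.mk (isIsomorphicSetoid P.FullSubcategory) X)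

/-- The subgroup generated by the relations
(1) `[X] = [X'] + [X'']` for every short exact sequence `0 ⟶ X' ⟶ X ⟶ X'' ⟶ 0`;
(2) `[X] = 0` if the homology of the underlying complex of `X` vanishes. -/
def relations : AddSubgroup (FreeGrp P) :=
  AddSubgroup.closure
    ({z | ∃ X' X X'' : P.FullSubcategory,
        HasShortExact U X'.obj X.obj X''.obj ∧ z = gen X - (gen X' + gen X'')} ∪
      {z | ∃ X : P.FullSubcategory, (U.obj X.obj).Acyclic ∧ z = gen X})

/-- The Grothendieck group of the full subcategory of `C` on the objects with the property `P`. -/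
def Grp : Type w := FreeGrp P ⧸ relations U P

instance : AddCommGroup (Grp U P) :=
  inferInstanceAs (AddCommGroup (FreeGrp P ⧸ relations U P))

variable {P} in
/-- The class of an object in the Grothendieck group. -/
def cls (X : P.FullSubcategory) : Grp U P :=
  QuotientAddGroup.mk' (relations U P) (gen X)

theorem hom_ext {A : Type*} [AddCommGroup A] {f g : Grp U P →+ A}
    (h : ∀ X : P.FullSubcategory, f (cls U X) = g (cls U X)) : f = g := by
  refine QuotientAddGroup.addMonoidHom_ext (relations U P) (FreeAbelianGroup.lift.symm.injective (funext ?_))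
  intro q
  induction q using Quotient.inductionOn with
  | h X => exact h X

variable {P} in
theorem cls_eq_of_iso {X Y : P.FullSubcategory} (e : X ≅ Y) : cls U X = cls U Y :=
  congrArg (fun q => QuotientAddGroup.mk' (relations U P) (FreeAbelianGroup.of q))
    (Quotient.sound (s := isIsomorphicSetoid P.FullSubcategory) ⟨e⟩)

end

section

variable {C : Type w} [Category.{v} C] {C' : Type w} [Category.{v} C']
  (U : C ⥤ ChainComplex (ModuleCat.{u} R) ℕ) (U' : C' ⥤ ChainComplex (ModuleCat.{u} R) ℕ)
  (P : ObjectProperty C) (P' : ObjectProperty C')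

/-- A functor that commutes with the forgetful functors to chain complexes and respects the
properties of objects induces a map `[X] ↦ [Φ X]` of Grothendieck groups. -/
def map (Φ : C ⥤ C') (hU : Φ ⋙ U' = U) (hP : ∀ X, P X → P' (Φ.obj X)) :
    Grp U P →+ Grp U' P' :=
  QuotientAddGroup.map (relations U P) (relations U' P')
    (FreeAbelianGroup.map
      (Quotient.map (sa := isIsomorphicSetoid P.FullSubcategory)
        (sb := isIsomorphicSetoid P'.FullSubcategory)
        (fun X => ⟨Φ.obj X.obj, hP X.obj X.property⟩)
        (fun _ _ h => h.elim fun e =>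
          ⟨P'.isoMk (Φ.mapIso (P.ι.mapIso e))⟩)))
    (by
      subst hU
      refine (AddSubgroup.closure_le _).2 ?_
      rintro z (⟨X', X, X'', ⟨f, g, h, hs⟩, rfl⟩ | ⟨X, hX, rfl⟩)
      · refine AddSubgroup.subset_closure (Or.inl
          ⟨⟨Φ.obj X'.obj, hP _ X'.property⟩, ⟨Φ.obj X.obj, hP _ X.property⟩,
            ⟨Φ.obj X''.obj, hP _ X''.property⟩, ⟨Φ.map f, Φ.map g, h, hs⟩, ?_⟩)
        simp [gen]
      · refine AddSubgroup.subset_closure (Or.inr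
          ⟨⟨Φ.obj X.obj, hP _ X.property⟩, hX, ?_⟩)
        simp [gen])

theorem map_cls (Φ : C ⥤ C') (hU : Φ ⋙ U' = U) (hP : ∀ X, P X → P' (Φ.obj X))
    (X : P.FullSubcategory) :
    map U U' P P' Φ hU hP (cls U X) = cls U' ⟨Φ.obj X.obj, hP X.obj X.property⟩ := by
  rw [map, cls, cls, QuotientAddGroup.mk'_apply, QuotientAddGroup.mk'_apply]
  refine (QuotientAddGroup.map_mk _ _ _ _ _).trans ?_
  rw [gen, FreeAbelianGroup.map_of_apply, Quotient.map_mk]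
  rfl

end

end GrothGrp

/-! ### Complexes of finitely generated projectives and the groups `K(R on S, n)` -/

section Complexes

variable {R : Type u} [CommRing R]

/-- The objects of `𝒫(R, n)`: bounded chain complexes of finitely generated projective modules
that vanish in all degrees `i ∉ [0, n]`; here `n` may be `∞`. -/
def IsPerf (n : ℕ∞) (C : ChainComplex (ModuleCat.{u} R) ℕ) : Prop :=
  (∀ i, Module.Finite R (C.X i) ∧ Module.Projective R (C.X i)) ∧
  (∃ N : ℕ, ∀ i, N < i → IsZero (C.X i)) ∧
  (∀ i : ℕ, n < (i : ℕ∞) → IsZero (C.X i))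

theorem IsPerf.mono {k n : ℕ∞} (h : k ≤ n) {C : ChainComplex (ModuleCat.{u} R) ℕ}
    (hC : IsPerf k C) : IsPerf n C :=
  ⟨hC.1, hC.2.1, fun i hi => hC.2.2 i (lt_of_le_of_lt h hi)⟩

/-- `C` is `S`-exact for a tuple `S = (S₁, …, S_d)` of multiplicative systems: the localized
complex `Sᵢ⁻¹ C` is exact for every `i`. -/
def IsSExact {d : ℕ} (S : Fin d → Submonoid R) (C : ChainComplex (ModuleCat.{u} R) ℕ) : Prop :=
  ∀ i, (((ModuleCat.localizedModuleFunctor.{u} (S i)).mapHomologicalComplex _).obj C).Acyclic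

/-- The property of being an `S`-exact complex in `𝒫(R, n)`. -/
def onProp {d : ℕ} (S : Fin d → Submonoid R) (n : ℕ∞) :
    ObjectProperty (ChainComplex (ModuleCat.{u} R) ℕ) :=
  fun C => IsPerf n C ∧ IsSExact S C

/-- The group `K(R on S, n)`, also denoted `G(R on S, n)`. -/
abbrev KOn {d : ℕ} (S : Fin d → Submonoid R) (n : ℕ∞) : Type (u + 1) :=
  GrothGrp.Grp (𝟭 (ChainComplex (ModuleCat.{u} R) ℕ)) (onProp S n)

/-- The map `K(R on S, k) → K(R on S, n)`, `k ≤ n`, induced by the inclusion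
`𝒫(R, k) ⊆ 𝒫(R, n)`. -/
def KOn.incl {d : ℕ} (S : Fin d → Submonoid R) {k n : ℕ∞} (h : k ≤ n) : KOn S k →+ KOn S n :=
  GrothGrp.map _ _ _ _ (𝟭 _) rfl (fun _ hC => ⟨hC.1.mono h, hC.2⟩)

end Complexes

/-! ### Differential graded algebras and their modules -/

/-- A differential graded `R`-algebra in nonnegative degrees, with differential of degree `-1`. -/
structure DGAlgebra (R : Type u) [CommRing R] where
  /-- the underlying algebra -/
  carrier : Type u
  [ring : Ring carrier]
  [algebra : Algebra R carrier]
  /-- the homogeneous parts -/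
  deg : ℕ → Submodule R carrier
  [graded : GradedAlgebra deg]
  /-- the differential -/
  d : carrier →ₗ[R] carrier
  d_zero : ∀ a ∈ deg 0, d a = 0
  d_succ : ∀ p, ∀ a ∈ deg (p + 1), d a ∈ deg p
  d_d : ∀ a, d (d a) = 0
  leibniz : ∀ p, ∀ a ∈ deg p, ∀ b, d (a * b) = d a * b + (-1 : R) ^ p • (a * d b)

attribute [instance] DGAlgebra.ring DGAlgebra.algebra DGAlgebra.graded

/-- A morphism of differential graded algebras. -/
structure DGAlgebra.Hom {R : Type u} [CommRing R] (A B : DGAlgebra R) where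
  /-- the underlying algebra homomorphism -/
  toAlgHom : A.carrier →ₐ[R] B.carrier
  map_deg : ∀ p, ∀ a ∈ A.deg p, toAlgHom a ∈ B.deg p
  map_d : ∀ a, toAlgHom (A.d a) = B.d (toAlgHom a)

/-- A left dg-module over `A` whose underlying chain complex is a complex of `R`-modules in
nonnegative degrees. An action of `A` on `⨁ Cᵢ` is given by its components:
`act q r a : C_q ⟶ C_r` is the component of the action of `a`. It vanishes for `a` homogeneous of
degree `p ≠ r - q`, that is, elements of degree `p` raise degrees by `p`. -/
structure DGModule {R : Type u} [CommRing R] (A : DGAlgebra R) where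
  /-- the underlying chain complex -/
  cx : ChainComplex (ModuleCat.{u} R) ℕ
  /-- the components of the action -/
  act : ∀ q r : ℕ, A.carrier →ₗ[R] (cx.X q →ₗ[R] cx.X r)
  act_deg : ∀ (p q r : ℕ), p + q ≠ r → ∀ a ∈ A.deg p, act q r a = 0
  act_one : ∀ (q : ℕ) (x : cx.X q), act q q 1 x = x
  act_mul : ∀ (p q r : ℕ) (a : A.carrier), ∀ b ∈ A.deg p, ∀ x : cx.X q,
    act q r (a * b) x = act (p + q) r a (act q (p + q) b x)
  /-- The Leibniz rule `d (a x) = (d a) x + (-1)^p a (d x)` for `a` of degree `p`. (For `q = 0` the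
  last summand is zero, since `cx.d 0 0 = 0`.) -/
  leibniz : ∀ (p q r : ℕ), ∀ a ∈ A.deg p, ∀ x : cx.X q,
    (cx.d (r + 1) r).hom (act q (r + 1) a x) =
      act q r (A.d a) x + (-1 : R) ^ p • act (q - 1) r a ((cx.d q (q - 1)).hom x)

namespace DGModule

variable {R : Type u} [CommRing R] {A B : DGAlgebra R}

/-- A morphism of dg-modules: a chain map that is compatible with the actions. -/
@[ext]
structure Hom (X Y : DGModule A) where
  /-- the underlying chain map -/
  chainMap : X.cx ⟶ Y.cx
  map_act : ∀ (q r : ℕ) (a : A.carrier) (x : X.cx.X q),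
    (chainMap.f r).hom (X.act q r a x) = Y.act q r a ((chainMap.f q).hom x)

instance : Category (DGModule A) where
  Hom := Hom
  id X := ⟨𝟙 X.cx, fun _ _ _ _ => rfl⟩
  comp f g := ⟨f.chainMap ≫ g.chainMap, fun q r a x => by
    simp [f.map_act, g.map_act]⟩

variable (A) in
/-- The underlying chain complex of a dg-module. -/
def forget : DGModule A ⥤ ChainComplex (ModuleCat.{u} R) ℕ where
  obj X := X.cx
  map f := f.chainMap

/-- Restriction of scalars along a morphism `A ⟶ B` of differential graded algebras. -/
def restrict (φ : A.Hom B) : DGModule B ⥤ DGModule A where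
  obj X :=
    { cx := X.cx
      act := fun q r => X.act q r ∘ₗ φ.toAlgHom.toLinearMap
      act_deg := fun p q r h a ha => X.act_deg p q r h _ (φ.map_deg p a ha)
      act_one := fun q x => by simp [X.act_one]
      act_mul := fun p q r a b hb x => by
        simp [X.act_mul p q r _ _ (φ.map_deg p b hb)]
      leibniz := fun p q r a ha x => by
        simpa [φ.map_d] using X.leibniz p q r _ (φ.map_deg p a ha) x }
  map f := ⟨f.chainMap, fun q r a x => f.map_act q r (φ.toAlgHom a) x⟩

/-- An isomorphism of chain complexes that is compatible with the actions is an isomorphism of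
dg-modules. -/
def isoMk {X Y : DGModule A} (e : X.cx ≅ Y.cx)
    (h : ∀ (q r : ℕ) (a : A.carrier) (x : X.cx.X q),
      (e.hom.f r).hom (X.act q r a x) = Y.act q r a ((e.hom.f q).hom x)) : X ≅ Y where
  hom := ⟨e.hom, h⟩
  inv := ⟨e.inv, fun q r a y => by
    have h1 : ∀ (q : ℕ) (x : X.cx.X q), (e.inv.f q).hom ((e.hom.f q).hom x) = x := fun q x => by
      exact congrArg (fun f : X.cx ⟶ X.cx => (f.f q).hom x) e.hom_inv_id
    have h2 : (e.hom.f q).hom ((e.inv.f q).hom y) = y := by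
      exact congrArg (fun f : Y.cx ⟶ Y.cx => (f.f q).hom y) e.inv_hom_id
    have h3 := congrArg (e.inv.f r).hom (h q r a ((e.inv.f q).hom y))
    rw [h1, h2] at h3
    exact h3.symm⟩
  hom_inv_id := Hom.ext e.hom_inv_id
  inv_hom_id := Hom.ext e.inv_hom_id

variable (A) in
/-- The property of dg-modules of lying in `𝒫(A, n)`: the underlying complex lies in `𝒫(R, n)`. -/
def perf (n : ℕ∞) : ObjectProperty (DGModule A) := fun X => IsPerf n X.cx

end DGModule

/-- The Grothendieck group `G(A, n)` of the category `𝒫(A, n)`. -/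
abbrev GDG {R : Type u} [CommRing R] (A : DGAlgebra R) (n : ℕ∞) : Type (u + 1) :=
  GrothGrp.Grp (DGModule.forget A) (DGModule.perf A n)

namespace GDG

variable {R : Type u} [CommRing R] {A B : DGAlgebra R}

variable (A) in
/-- The map `i : G(A, k) → G(A, n)`, `k ≤ n`, induced by the inclusion `𝒫(A, k) ⊆ 𝒫(A, n)`. -/
def incl {k n : ℕ∞} (h : k ≤ n) : GDG A k →+ GDG A n :=
  GrothGrp.map _ _ _ _ (𝟭 _) rfl (fun _ hC => hC.mono h)

/-- The map `G(B, n) → G(A, n)` induced by restriction of scalars along `A ⟶ B`. -/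
def res (φ : A.Hom B) (n : ℕ∞) : GDG B n →+ GDG A n :=
  GrothGrp.map _ _ _ _ (DGModule.restrict φ) rfl (fun _ hC => hC)

theorem incl_cls {k n : ℕ∞} (h : k ≤ n) (X : (DGModule.perf A k).FullSubcategory) :
    incl A h (GrothGrp.cls (DGModule.forget A) X) =
      GrothGrp.cls (DGModule.forget A) ⟨X.obj, X.property.mono h⟩ :=
  GrothGrp.map_cls _ _ _ _ _ _ _ X

theorem res_cls (φ : A.Hom B) (n : ℕ∞) (X : (DGModule.perf B n).FullSubcategory) :
    res φ n (GrothGrp.cls (DGModule.forget B) X) =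
      GrothGrp.cls (DGModule.forget A) ⟨(DGModule.restrict φ).obj X.obj, X.property⟩ :=
  GrothGrp.map_cls _ _ _ _ _ _ _ X

theorem res_id (φ : A.Hom A) (h : ∀ a, φ.toAlgHom a = a) (n : ℕ∞) :
    res φ n = AddMonoidHom.id (GDG A n) := by
  refine GrothGrp.hom_ext (DGModule.forget A) (DGModule.perf A n) fun X => ?_
  rw [res_cls]
  refine GrothGrp.cls_eq_of_iso _ (ObjectProperty.isoMk _
    (DGModule.isoMk (Iso.refl X.obj.cx) fun q r a x => ?_))
  exact congrArg (fun b => X.obj.act q r b x) (h a)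

theorem res_comp {A' : DGAlgebra R} (φ : A.Hom B) (ψ : B.Hom A') (χ : A.Hom A')
    (h : ∀ a, χ.toAlgHom a = ψ.toAlgHom (φ.toAlgHom a)) (n : ℕ∞) :
    res χ n = (res φ n).comp (res ψ n) := by
  refine GrothGrp.hom_ext (DGModule.forget A') (DGModule.perf A' n) fun X => ?_
  rw [AddMonoidHom.comp_apply, res_cls, res_cls, res_cls]
  refine GrothGrp.cls_eq_of_iso _ (ObjectProperty.isoMk _
    (DGModule.isoMk (Iso.refl X.obj.cx) fun q r a x => ?_))
  exact congrArg (fun b => X.obj.act q r b x) (h a)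

end GDG

/-! ### The free differential graded algebras `T_s` -/

namespace FreeDGA

variable {R : Type u} [CommRing R] {d : ℕ}

/-- The part of degree `p` of the free algebra on `e₁, …, e_d`: the span of the words of length
`p`. -/
def deg (R : Type u) [CommRing R] (d p : ℕ) : Submodule R (FreeAlgebra R (Fin d)) :=
  Submodule.span R (Set.range (FreeAlgebra.ι R : Fin d → FreeAlgebra R (Fin d))) ^ p

theorem ι_mem (i : Fin d) : FreeAlgebra.ι R i ∈ deg R d 1 := by
  rw [deg, pow_one]
  exact Submodule.subset_span ⟨i, rfl⟩

instance : SetLike.GradedMonoid (deg R d) := Submodule.nat_power_gradedMonoid _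

open scoped DirectSum in
instance graded : GradedAlgebra (deg R d) :=
  GradedAlgebra.ofAlgHom _
    (FreeAlgebra.lift R fun i => DirectSum.of (fun p => deg R d p) 1 ⟨FreeAlgebra.ι R i, ι_mem i⟩)
    (by
      ext i
      simp)
    (fun p x => by
      obtain ⟨x, hx⟩ := x
      dsimp only
      induction hx using Submodule.pow_induction_on_left' with
      | algebraMap r =>
        rw [AlgHom.commutes, DirectSum.algebraMap_apply]; rfl
      | add x y i hx hy ihx ihy =>
        rw [map_add, ihx, ihy, ← map_add]
        rfl
      | mem_mul m hm i x hx ih =>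
        rw [map_mul, ih]
        have key : FreeAlgebra.lift R
            (fun i => DirectSum.of (fun p => deg R d p) 1 ⟨FreeAlgebra.ι R i, ι_mem i⟩) m =
            DirectSum.of (fun p => deg R d p) 1 ⟨m, by rw [deg, pow_one]; exact hm⟩ := by
          induction hm using Submodule.span_induction with
          | mem x h => obtain ⟨j, rfl⟩ := h; rw [FreeAlgebra.lift_ι_apply]
          | zero => rw [map_zero]; exact (map_zero _).symm
          | add x y _ _ hx hy => rw [map_add, hx, hy, ← map_add]; rfl
          | smul r x _ hx =>
            rw [map_smul, hx]
            exact (DirectSum.lof R ℕ (fun p => deg R d p) 1).map_smul r _ |>.symm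
        rw [key, DirectSum.of_mul_of]
        exact DirectSum.of_eq_of_gradedMonoid_eq (Sigma.subtype_ext (add_comm _ _) rfl))

/-- The algebra map `a ↦ !![α a, ∂ a; 0, a]`, where `α` multiplies elements of degree `p` by
`(-1)^p` and `∂` is the differential with `∂ eᵢ = sᵢ`. -/
noncomputable def triangular (s : Fin d → R) :
    FreeAlgebra R (Fin d) →ₐ[R] Matrix (Fin 2) (Fin 2) (FreeAlgebra R (Fin d)) :=
  FreeAlgebra.lift R fun i =>
    !![-FreeAlgebra.ι R i, algebraMap R _ (s i); 0, FreeAlgebra.ι R i]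

/-- The differential of `T_s`: the graded derivation with `eᵢ ↦ sᵢ`. -/
noncomputable def diff (s : Fin d → R) : FreeAlgebra R (Fin d) →ₗ[R] FreeAlgebra R (Fin d) where
  toFun a := triangular s a 0 1
  map_add' a b := by simp
  map_smul' r a := by simp

theorem triangular_bottom (s : Fin d → R) (a : FreeAlgebra R (Fin d)) :
    triangular s a 1 0 = 0 ∧ triangular s a 1 1 = a := by
  induction a using FreeAlgebra.induction with
  | grade0 r => simp [Matrix.algebraMap_matrix_apply]
  | grade1 i => simp [triangular]
  | mul a b ha hb => simp [Matrix.mul_apply, ha, hb]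
  | add a b ha hb => simp [ha, hb]

theorem diff_ι (s : Fin d → R) (i : Fin d) :
    diff s (FreeAlgebra.ι R i) = algebraMap R _ (s i) := by
  simp [diff, triangular]

theorem diff_algebraMap (s : Fin d → R) (r : R) : diff s (algebraMap R _ r) = 0 := by
  simp [diff, Matrix.algebraMap_matrix_apply]

theorem triangular_top (s : Fin d → R) (p : ℕ) (a : FreeAlgebra R (Fin d)) (ha : a ∈ deg R d p) :
    triangular s a 0 0 = (-1 : R) ^ p • a := by
  induction ha using Submodule.pow_induction_on_left' with
  | algebraMap r => simp [Matrix.algebraMap_matrix_apply]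
  | add x y i hx hy ihx ihy => simp [ihx, ihy]
  | mem_mul m hm i x hx ih =>
    have key : triangular s m 0 0 = - m := by
      induction hm using Submodule.span_induction with
      | mem x h => obtain ⟨j, rfl⟩ := h; simp [triangular]
      | zero => simp
      | add x y _ _ hx hy => simp [hx, hy, add_comm]
      | smul r x _ hx => simp [hx]
    simp [Matrix.mul_apply, key, ih, triangular_bottom, pow_succ]

theorem diff_mul (s : Fin d → R) (p : ℕ) (a : FreeAlgebra R (Fin d)) (ha : a ∈ deg R d p)
    (b : FreeAlgebra R (Fin d)) :
    diff s (a * b) = diff s a * b + (-1 : R) ^ p • (a * diff s b) := by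
  simp [diff, Matrix.mul_apply, triangular_bottom, triangular_top s p a ha, add_comm]

theorem diff_of_mem_span (s : Fin d → R) (m : FreeAlgebra R (Fin d))
    (hm : m ∈ Submodule.span R (Set.range (FreeAlgebra.ι R : Fin d → FreeAlgebra R (Fin d)))) :
    ∃ r : R, diff s m = algebraMap R _ r := by
  induction hm using Submodule.span_induction with
  | mem x h => obtain ⟨j, rfl⟩ := h; exact ⟨_, diff_ι s j⟩
  | zero => exact ⟨0, by simp⟩
  | add x y _ _ hx hy =>
    obtain ⟨r, hr⟩ := hx
    obtain ⟨t, ht⟩ := hy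
    exact ⟨r + t, by simp [hr, ht]⟩
  | smul r x _ hx =>
    obtain ⟨t, ht⟩ := hx
    exact ⟨r * t, by rw [map_smul, ht, Algebra.smul_def, map_mul]⟩

theorem diff_zero (s : Fin d → R) (a : FreeAlgebra R (Fin d)) (ha : a ∈ deg R d 0) :
    diff s a = 0 := by
  rw [deg, pow_zero] at ha
  obtain ⟨r, rfl⟩ := Submodule.mem_one.1 ha
  exact diff_algebraMap s r

theorem diff_succ (s : Fin d → R) (p : ℕ) (a : FreeAlgebra R (Fin d)) (ha : a ∈ deg R d (p + 1)) :
    diff s a ∈ deg R d p := by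
  induction p generalizing a with
  | zero =>
    rw [deg, zero_add, pow_one] at ha
    obtain ⟨r, hr⟩ := diff_of_mem_span s a ha
    rw [hr, deg, pow_zero]
    exact Submodule.algebraMap_mem r
  | succ p ih =>
    rw [deg, pow_succ'] at ha
    induction ha using Submodule.mul_induction_on' with
    | mem_mul_mem m hm x hx =>
      have hm' : m ∈ deg R d 1 := by rwa [deg, pow_one]
      obtain ⟨r, hr⟩ := diff_of_mem_span s m hm
      rw [diff_mul s 1 m hm', hr, ← Algebra.smul_def]
      refine add_mem (Submodule.smul_mem _ _ hx) (Submodule.smul_mem _ _ ?_)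
      rw [deg, pow_succ']
      exact Submodule.mul_mem_mul hm (ih x hx)
    | add x _ y _ hx hy => rw [map_add]; exact add_mem hx hy

theorem diff_diff (s : Fin d → R) (a : FreeAlgebra R (Fin d)) : diff s (diff s a) = 0 := by
  have key : ∀ p, ∀ a ∈ deg R d p, diff s (diff s a) = 0 := by
    intro p
    induction p with
    | zero => intro a ha; rw [diff_zero s a ha, map_zero]
    | succ p ih =>
      intro a ha
      rw [deg, pow_succ'] at ha
      induction ha using Submodule.mul_induction_on' with
      | mem_mul_mem m hm x hx =>
        have hm' : m ∈ deg R d 1 := by rwa [deg, pow_one]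
        obtain ⟨r, hr⟩ := diff_of_mem_span s m hm
        rw [diff_mul s 1 m hm', hr, ← Algebra.smul_def, map_add, map_smul, map_smul,
          diff_mul s 1 m hm', ih x hx, hr, ← Algebra.smul_def]
        simp
      | add x _ y _ hx hy => rw [map_add, map_add, hx, hy, add_zero]
  induction a using DirectSum.Decomposition.inductionOn (deg R d) with
  | zero => simp
  | homogeneous a => exact key _ _ a.2
  | add a b ha hb => rw [map_add, map_add, ha, hb, add_zero]

end FreeDGA

section TDGA

variable {R : Type u} [CommRing R] {d : ℕ}

/-- `T_s`: the free differential graded `R`-algebra on generators `e₁, …, e_d` of degree `1` with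
`d eᵢ = sᵢ`. -/
noncomputable abbrev TDGA (s : Fin d → R) : DGAlgebra R where
  carrier := FreeAlgebra R (Fin d)
  deg := FreeDGA.deg R d
  d := FreeDGA.diff s
  d_zero := FreeDGA.diff_zero s
  d_succ := FreeDGA.diff_succ s
  d_d := FreeDGA.diff_diff s
  leibniz := FreeDGA.diff_mul s

/-- The algebra endomorphism `eᵢ ↦ tᵢ eᵢ` of the free algebra. -/
noncomputable def FreeDGA.scale (t : Fin d → R) :
    FreeAlgebra R (Fin d) →ₐ[R] FreeAlgebra R (Fin d) :=
  FreeAlgebra.lift R fun i => t i • FreeAlgebra.ι R i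

theorem FreeDGA.scale_mem (t : Fin d → R) (p : ℕ) (a : FreeAlgebra R (Fin d))
    (ha : a ∈ FreeDGA.deg R d p) : FreeDGA.scale t a ∈ FreeDGA.deg R d p := by
  have h := Submodule.mem_map_of_mem (f := (FreeDGA.scale t).toLinearMap) ha
  rw [FreeDGA.deg, Submodule.map_pow] at h
  have hle : Submodule.map (FreeDGA.scale t).toLinearMap
      (Submodule.span R (Set.range (FreeAlgebra.ι R : Fin d → FreeAlgebra R (Fin d)))) ≤
      Submodule.span R (Set.range (FreeAlgebra.ι R : Fin d → FreeAlgebra R (Fin d))) := by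
    rw [Submodule.map_span, Submodule.span_le]
    rintro _ ⟨_, ⟨i, rfl⟩, rfl⟩
    simp only [AlgHom.toLinearMap_apply, FreeDGA.scale, FreeAlgebra.lift_ι_apply]
    exact Submodule.smul_mem _ _ (Submodule.subset_span ⟨i, rfl⟩)
  have hp := pow_le_pow_left' hle p
  exact hp h

/-- The morphism `T_u ⟶ T_s`, `eᵢ ↦ tᵢ eᵢ`, for `u = s t`. -/
noncomputable def TDGA.map {s t u : Fin d → R} (h : ∀ i, s i * t i = u i) :
    (TDGA u).Hom (TDGA s) where
  toAlgHom := FreeDGA.scale t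
  map_deg := FreeDGA.scale_mem t
  map_d := by
    change ∀ a, FreeDGA.scale t (FreeDGA.diff u a) = FreeDGA.diff s (FreeDGA.scale t a)
    intro a
    have key : ∀ p, ∀ a ∈ FreeDGA.deg R d p,
        FreeDGA.scale t (FreeDGA.diff u a) = FreeDGA.diff s (FreeDGA.scale t a) := by
      intro p a ha
      induction ha using Submodule.pow_induction_on_left' with
      | algebraMap r => simp [FreeDGA.diff_algebraMap]
      | add x y i hx hy ihx ihy => simp [ihx, ihy]
      | mem_mul m hm i x hx ih =>
        have hm' : m ∈ FreeDGA.deg R d 1 := by rwa [FreeDGA.deg, pow_one]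
        have hd : FreeDGA.scale t (FreeDGA.diff u m) = FreeDGA.diff s (FreeDGA.scale t m) := by
          clear ih hm'
          induction hm using Submodule.span_induction with
          | mem x hx =>
            obtain ⟨j, rfl⟩ := hx
            rw [FreeDGA.diff_ι, AlgHom.commutes, FreeDGA.scale, FreeAlgebra.lift_ι_apply, map_smul,
              FreeDGA.diff_ι, Algebra.smul_def, ← map_mul, ← h j, mul_comm]
          | zero => simp
          | add x y _ _ hx hy => simp [hx, hy]
          | smul r x _ hx => simp [hx]
        rw [FreeDGA.diff_mul u 1 m hm', map_mul,
          FreeDGA.diff_mul s 1 _ (FreeDGA.scale_mem t 1 m hm'), ← hd, ← ih]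
        simp
    induction a using DirectSum.Decomposition.inductionOn (FreeDGA.deg R d) with
    | zero => simp
    | homogeneous a => exact key _ _ a.2
    | add a b ha hb => simp [ha, hb]

end TDGA

/-! ### The translation category and the diagram `s ↦ G(T_s, n)` -/

/-- The translation category `tS` of a multiplicative system `S`: the objects are the elements of
`S`, and the morphisms `s ⟶ t` are the elements `x ∈ S` with `s x = t`. -/
structure TransCat {R : Type u} [CommRing R] (S : Submonoid R) where
  /-- the element of `S` -/
  elt : S

instance {R : Type u} [CommRing R] (S : Submonoid R) : Category (TransCat S) where
  Hom s t := {x : S // s.elt * x = t.elt}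
  id s := ⟨1, mul_one _⟩
  comp f g := ⟨f.1 * g.1, by rw [← mul_assoc, f.2, g.2]⟩
  id_comp f := Subtype.ext (one_mul _)
  comp_id f := Subtype.ext (mul_one _)
  assoc f g h := Subtype.ext (mul_assoc _ _ _)

section Colimit

variable {R : Type u} [CommRing R] {d : ℕ}

/-- The product category `tS₁ × ⋯ × tS_d`. -/
abbrev TransProd (S : Fin d → Submonoid R) : Type u := ∀ i, TransCat (S i)

/-- The tuple in `R^d` underlying an object of `tS₁ × ⋯ × tS_d`. -/
def TransProd.val {S : Fin d → Submonoid R} (s : TransProd S) : Fin d → R := fun i => (s i).elt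

theorem TransProd.mul_eq {S : Fin d → Submonoid R} {s t : TransProd S} (f : s ⟶ t) (i : Fin d) :
    s.val i * ((f i).1 : R) = t.val i :=
  congrArg Subtype.val (f i).2

/-- The diagram `tS₁ × ⋯ × tS_d ⥤ Ab`, `s ↦ G(T_s, n)`. -/
noncomputable def colimDiagram (S : Fin d → Submonoid R) (n : ℕ∞) :
    TransProd S ⥤ AddCommGrpCat.{u + 1} where
  obj s := AddCommGrpCat.of (GDG (TDGA s.val) n)
  map f := AddCommGrpCat.ofHom (GDG.res (TDGA.map (TransProd.mul_eq f)) n)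
  map_id s := by
    refine AddCommGrpCat.hom_ext (GDG.res_id _ (fun a => ?_) n)
    have h : FreeDGA.scale (fun i => (((𝟙 s : s ⟶ s) i).1 : R)) = AlgHom.id R _ :=
      FreeAlgebra.hom_ext (funext fun i => by
        change FreeDGA.scale _ (FreeAlgebra.ι R i) = _
        rw [FreeDGA.scale, FreeAlgebra.lift_ι_apply]
        exact one_smul R _)
    exact congrArg (fun φ : FreeAlgebra R (Fin d) →ₐ[R] FreeAlgebra R (Fin d) => φ a) h
  map_comp f g := by
    refine AddCommGrpCat.hom_ext (GDG.res_comp _ _ _ (fun a => ?_) n)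
    have h : FreeDGA.scale (fun i => (((f ≫ g) i).1 : R)) =
        (FreeDGA.scale fun i => ((f i).1 : R)).comp (FreeDGA.scale fun i => ((g i).1 : R)) :=
      FreeAlgebra.hom_ext (funext fun i => by
        change FreeDGA.scale _ (FreeAlgebra.ι R i) =
          FreeDGA.scale _ (FreeDGA.scale _ (FreeAlgebra.ι R i))
        rw [FreeDGA.scale, FreeAlgebra.lift_ι_apply, FreeDGA.scale, FreeDGA.scale,
          FreeAlgebra.lift_ι_apply, map_smul, FreeAlgebra.lift_ι_apply, smul_smul, mul_comm]
        rfl)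
    exact congrArg (fun φ : FreeAlgebra R (Fin d) →ₐ[R] FreeAlgebra R (Fin d) => φ a) h

/-- Multiplication by `sᵢ` is null-homotopic on a `T_s`-module, so a `T_s`-module with `sᵢ ∈ Sᵢ`
for all `i` is `S`-exact. -/
theorem isSExact_of_TDGA {S : Fin d → Submonoid R} {s : Fin d → R} (hs : ∀ i, s i ∈ S i)
    (X : DGModule (TDGA s)) : IsSExact S X.cx := by
  intro i q
  have hh : ∀ x : X.cx.X q, (X.cx.d q (q - 1)).hom x = 0 → ∃ y : X.cx.X (q + 1),
      (X.cx.d (q + 1) q).hom y = s i • x := by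
    intro x hx
    refine ⟨X.act q (q + 1) (FreeAlgebra.ι R i) x, ?_⟩
    have h := X.leibniz 1 q q (FreeAlgebra.ι R i) (FreeDGA.ι_mem i) x
    rw [hx, map_zero, smul_zero, add_zero] at h
    rw [h]
    have h1 : (TDGA s).d (FreeAlgebra.ι R i) = s i • (1 : (TDGA s).carrier) :=
      (FreeDGA.diff_ι s i).trans (Algebra.algebraMap_eq_smul_one _)
    rw [h1, map_smul, LinearMap.smul_apply, X.act_one]
  rw [HomologicalComplex.exactAt_iff' _ (q + 1) q (q - 1) (by simp) (by cases q <;> simp),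
    ShortComplex.ShortExact.moduleCat_exact_iff_function_exact]
  intro y
  constructor
  · intro hy
    obtain ⟨⟨x, t⟩, rfl⟩ := IsLocalizedModule.mk'_surjective (S i)
      ((X.cx.X q).localizedModuleMkLinearMap (S i)) y
    have hy' : IsLocalizedModule.mk' ((X.cx.X (q - 1)).localizedModuleMkLinearMap (S i))
        ((X.cx.d q (q - 1)).hom x) t = 0 :=
      (IsLocalizedModule.map_mk' (S i) ((X.cx.X q).localizedModuleMkLinearMap (S i))
        ((X.cx.X (q - 1)).localizedModuleMkLinearMap (S i)) (X.cx.d q (q - 1)).hom x t).symm.trans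
        hy
    obtain ⟨c, hc⟩ := (IsLocalizedModule.mk'_eq_zero' _ t).1 hy'
    obtain ⟨z, hz⟩ := hh (c • x) (by
      rw [Submonoid.smul_def, map_smul, ← Submonoid.smul_def, hc])
    let z' : (X.cx.X (q + 1)).localizedModule (S i) :=
      IsLocalizedModule.mk' ((X.cx.X (q + 1)).localizedModuleMkLinearMap (S i)) z
        ((⟨s i, hs i⟩ * c) * t)
    refine ⟨z', ?_⟩
    refine (IsLocalizedModule.map_mk' (S i)
      ((X.cx.X (q + 1)).localizedModuleMkLinearMap (S i))
      ((X.cx.X q).localizedModuleMkLinearMap (S i)) (X.cx.d (q + 1) q).hom z _).trans ?_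
    rw [hz]
    have h2 : s i • c • x = ((⟨s i, hs i⟩ * c : S i)) • x := by
      rw [mul_smul]; rfl
    rw [h2]
    exact IsLocalizedModule.mk'_cancel_left _ _ _ _
  · rintro ⟨z, rfl⟩
    have h0 := ((((ModuleCat.localizedModuleFunctor.{u} (S i)).mapHomologicalComplex _).obj
      X.cx).sc' (q + 1) q (q - 1)).zero
    exact congrArg (fun f => f.hom z) h0

/-- The map `G(T_s, n) → G(R on S, n)` that forgets the `T_s`-module structure. -/
noncomputable def GDG.toKOn {S : Fin d → Submonoid R} {s : Fin d → R} (hs : ∀ i, s i ∈ S i)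
    (n : ℕ∞) : GDG (TDGA s) n →+ KOn S n :=
  GrothGrp.map _ _ _ _ (DGModule.forget (TDGA s)) rfl
    (fun X hX => ⟨hX, isSExact_of_TDGA hs X⟩)

theorem GDG.toKOn_cls {S : Fin d → Submonoid R} {s : Fin d → R} (hs : ∀ i, s i ∈ S i) (n : ℕ∞)
    (X : (DGModule.perf (TDGA s) n).FullSubcategory) :
    GDG.toKOn hs n (GrothGrp.cls (DGModule.forget (TDGA s)) X) =
      GrothGrp.cls (𝟭 _)
        (⟨X.obj.cx, X.property, isSExact_of_TDGA hs X.obj⟩ : (onProp S n).FullSubcategory) :=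
  GrothGrp.map_cls _ _ _ _ _ _ _ X

theorem GDG.toKOn_res {S : Fin d → Submonoid R} {s t : Fin d → R}
    (φ : (TDGA t).Hom (TDGA s)) (hs : ∀ i, s i ∈ S i) (ht : ∀ i, t i ∈ S i) (n : ℕ∞) :
    (GDG.toKOn ht n).comp (GDG.res φ n) = GDG.toKOn hs n := by
  refine GrothGrp.hom_ext (DGModule.forget (TDGA s)) (DGModule.perf (TDGA s) n) fun X => ?_
  rw [AddMonoidHom.comp_apply, GDG.res_cls, GDG.toKOn_cls, GDG.toKOn_cls]
  rfl

/-- The maps `G(T_s, n) → G(R on S, n)` as a cocone on the diagram `s ↦ G(T_s, n)`. -/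
noncomputable def colimCocone (S : Fin d → Submonoid R) (n : ℕ∞) :
    Cocone (colimDiagram S n) where
  pt := AddCommGrpCat.of (KOn S n)
  ι :=
    { app := fun s => AddCommGrpCat.ofHom (GDG.toKOn (fun i => (s i).elt.2) n)
      naturality := fun s t f => by
        exact AddCommGrpCat.hom_ext (GDG.toKOn_res (TDGA.map (TransProd.mul_eq f))
          (fun i => (s i).elt.2) (fun i => (t i).elt.2) n) }

/-- The map `colim_s G(T_s, n) → G(R on S, n)`. -/
noncomputable def colimToKOn (S : Fin d → Submonoid R) (n : ℕ∞) :
    colimit (colimDiagram S n) ⟶ AddCommGrpCat.of (KOn S n) :=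
  colimit.desc (colimDiagram S n) (colimCocone S n)

end Colimit

/-!
A module over `T_s` is a complex `X` with maps `eᵢ` of degree one such that `d eᵢ + eᵢ d = sᵢ`; as
`T_s` is free, there is no further condition (`TMod`, `TMod.toDG`, `TMod.map_act`). The proof rests
on one way to correct maps that are homotopies only approximately: if `d h + h d = s + ε` with
`ε² = 0`, then `s h - h ε` is a homotopy from `s²` to zero (`ModCx.isNullhtpy_correct`). It has two
applications.

* For any chain map `φ : A ⟶ B` between `T_s`-modules, equivariant or not, the homotopy fibre of `φ`
  is a module over `T_{s²}`, compatibly with the structures on `A` and `B` restricted to `T_{s²}`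
  (`TMod.fib`). When `H₀(φ)` is onto, it can be truncated to nonnegative degrees and still consists
  of projectives. It then lies in `[0, n]` if `A` does and `B` lies in `[0, n + 1]`.
* In a degreewise split extension of `T_s`-modules as complexes, the middle term is a module over
  `T_{s²}`, compatibly with the restricted structures (`ModCx.IsShortExact.exists_isNullhtpy`).

*The homomorphism `W`.* Let `B` be a `T_s`-module in `[0, n + 1]`. If `φ : A ⟶ B` is a chain map
from a `T_s`-module in `[0, n]` with `H₀(φ)` onto, then `[A] - [fib φ]` is an element of `G(T_{s²}, n)`
that does not depend on `A` and `φ`: for a second choice `A' ⟶ B`, the fibre of `A ⊕ A' ⟶ B` is an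
extension of `A'` by `fib φ`, and also of `A` by the fibre of `A' ⟶ B` (`TMod.diffCl_eq`).
Additivity in `B` and the vanishing on acyclic `B` follow with the same freedom of choice. Such an `A` exists
for `d ≤ n`: the Koszul complex of `s` with coefficients in `B₀` maps to `B` by
`e_{i₁} ∧ ⋯ ∧ e_{iₖ} ⊗ x ↦ e_{i₁} ⋯ e_{iₖ} x` (`TMod.exists_cover`). This defines `W`. If `B` itself
lies in `[0, n]`, then `A = B` is allowed, and the fibre of the identity is acyclic. Hence
`[A] - [fib φ] = [B]` in `G(T_{s²}, n)`, which gives both `W i = j` and `i W = j`.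

*The colimit.* A complex in `K(R on S, n)` has the structure of a `T_s`-module for some `s` in
`S₁ × ⋯ × S_d` (`TMod.exists_structure`). Its class in the colimit does not depend on the structure:
for two structures over the same `T_s`, the identity is a chain map between two `T_s`-modules with
acyclic fibre, so the classes agree in `G(T_{s²}, n)` (`TMod.toColim_cl_eq`). The class is additive
by the statement on extensions, and so defines the inverse of `colim G(T_s, n) → K(R on S, n)`.

*The groups `K(R on S, n)`.* The maps `W` are natural in `s`, so they induce maps
`K(R on S, n + 1) → K(R on S, n)` inverse to the inclusions. The case `n = ∞` follows, as each
complex is bounded.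
-/

/-! ### Homomorphisms out of Grothendieck groups -/

namespace GrothGrp

section

variable {R : Type u} [CommRing R] {C : Type w} [Category.{v} C]
  {U : C ⥤ ChainComplex (ModuleCat.{u} R) ℕ} {P : ObjectProperty C}

theorem cls_eq_add {X' X X'' : P.FullSubcategory} (h : HasShortExact U X'.obj X.obj X''.obj) :
    cls U X = cls U X' + cls U X'' := by
  have h0 : gen X - (gen X' + gen X'') ∈ relations U P :=
    AddSubgroup.subset_closure (Or.inl ⟨X', X, X'', h, rfl⟩)
  have h1 := (QuotientAddGroup.eq_zero_iff _).2 h0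
  exact sub_eq_zero.1 h1

theorem cls_eq_zero {X : P.FullSubcategory} (h : (U.obj X.obj).Acyclic) : cls U X = 0 :=
  (QuotientAddGroup.eq_zero_iff _).2 (AddSubgroup.subset_closure (Or.inr ⟨X, h, rfl⟩))

theorem acyclic_of_isZero {K : ChainComplex (ModuleCat.{u} R) ℕ} (h : IsZero K) : K.Acyclic :=
  fun i => ShortComplex.exact_of_isZero_X₂ _
    (Functor.map_isZero (HomologicalComplex.eval _ _ i) h)

/-- An isomorphism `X ≅ Y` and a zero object `Z` form a short exact sequence `X ⟶ Y ⟶ Z`. -/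
theorem hasShortExact_of_iso {X Y Z : C} (e : X ≅ Y) (hZ : IsZero (U.obj Z)) (g : Y ⟶ Z) :
    HasShortExact U X Y Z := by
  have hs : (ShortComplex.mk (U.map e.hom) (U.map g) (hZ.eq_of_tgt _ _)).Splitting :=
    { r := U.map e.inv
      s := 0
      f_r := by simp [← U.map_comp]
      s_g := hZ.eq_of_tgt _ _
      id := by simp [← U.map_comp] }
  exact ⟨e.hom, g, _, hs.shortExact⟩

variable (U P) in
/-- A function on objects that is additive on short exact sequences and kills acyclic objects
induces a homomorphism on the Grothendieck group. Invariance under isomorphism is automatic once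
`C` has a zero object `Z`. -/
noncomputable def lift {A : Type*} [AddCommGroup A] (f : P.FullSubcategory → A)
    (Z : P.FullSubcategory) (hZ : IsZero (U.obj Z.obj)) (toZ : ∀ X : C, X ⟶ Z.obj)
    (hadd : ∀ X' X X'' : P.FullSubcategory, HasShortExact U X'.obj X.obj X''.obj →
      f X = f X' + f X'')
    (hzero : ∀ X : P.FullSubcategory, (U.obj X.obj).Acyclic → f X = 0) : Grp U P →+ A :=
  QuotientAddGroup.lift (relations U P)
    (FreeAbelianGroup.lift (Quotient.lift f (by
      rintro X Y ⟨e⟩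
      have h := hadd X Y Z (hasShortExact_of_iso (P.ι.mapIso e) hZ (toZ _))
      rw [h, hzero Z (acyclic_of_isZero hZ), add_zero])))
    (by
      refine (AddSubgroup.closure_le _).2 ?_
      rintro z (⟨X', X, X'', h, rfl⟩ | ⟨X, hX, rfl⟩)
      · simp [gen, hadd _ _ _ h, AddMonoidHom.mem_ker]
      · simp [gen, hzero _ hX, AddMonoidHom.mem_ker])

theorem lift_cls {A : Type*} [AddCommGroup A] (f : P.FullSubcategory → A)
    (Z : P.FullSubcategory) (hZ : IsZero (U.obj Z.obj)) (toZ : ∀ X : C, X ⟶ Z.obj)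
    (hadd : ∀ X' X X'' : P.FullSubcategory, HasShortExact U X'.obj X.obj X''.obj →
      f X = f X' + f X'')
    (hzero : ∀ X : P.FullSubcategory, (U.obj X.obj).Acyclic → f X = 0) (X : P.FullSubcategory) :
    lift U P f Z hZ toZ hadd hzero (cls U X) = f X := by
  rw [lift, cls, QuotientAddGroup.mk'_apply]
  refine (QuotientAddGroup.lift_mk _ _ _).trans ?_
  rw [gen, FreeAbelianGroup.lift_apply_of]
  rfl

end

end GrothGrp

/-! ### Chain complexes of modules in terms of elements -/

namespace ModCx

variable {R : Type u} [CommRing R]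

/-- The differential `X_{m+1} → X_m` as a linear map. -/
abbrev del (X : ChainComplex (ModuleCat.{u} R) ℕ) (m : ℕ) : X.X (m + 1) →ₗ[R] X.X m :=
  (X.d (m + 1) m).hom

/-- The component of a chain map in degree `m` as a linear map. -/
abbrev app {X Y : ChainComplex (ModuleCat.{u} R) ℕ} (φ : X ⟶ Y) (m : ℕ) : X.X m →ₗ[R] Y.X m :=
  (φ.f m).hom

theorem del_del (X : ChainComplex (ModuleCat.{u} R) ℕ) (m : ℕ) (x : X.X (m + 2)) :
    del X m (del X (m + 1) x) = 0 :=
  congrArg (fun f : X.X (m + 2) ⟶ X.X m => f.hom x) (X.d_comp_d (m + 2) (m + 1) m)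

theorem app_del {X Y : ChainComplex (ModuleCat.{u} R) ℕ} (φ : X ⟶ Y) (m : ℕ) (x : X.X (m + 1)) :
    app φ m (del X m x) = del Y m (app φ (m + 1) x) :=
  (congrArg (fun f : X.X (m + 1) ⟶ Y.X m => f.hom x) (φ.comm (m + 1) m)).symm

/-- The chain complex with given modules and differentials. -/
abbrev ofDel (X : ℕ → ModuleCat.{u} R) (δ : ∀ m, X (m + 1) →ₗ[R] X m)
    (h : ∀ m x, δ m (δ (m + 1) x) = 0) : ChainComplex (ModuleCat.{u} R) ℕ where
  X := X
  d := ChainComplex.of.d X fun m => ModuleCat.ofHom (δ m)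
  shape := (ChainComplex.of X (fun m => ModuleCat.ofHom (δ m))
    fun m => ModuleCat.hom_ext (LinearMap.ext (h m))).shape
  d_comp_d' := (ChainComplex.of X (fun m => ModuleCat.ofHom (δ m))
    fun m => ModuleCat.hom_ext (LinearMap.ext (h m))).d_comp_d'

theorem del_ofDel (X : ℕ → ModuleCat.{u} R) (δ : ∀ m, X (m + 1) →ₗ[R] X m)
    (h : ∀ m x, δ m (δ (m + 1) x) = 0) (m : ℕ) : del (ofDel X δ h) m = δ m :=
  congrArg ModuleCat.Hom.hom (ChainComplex.of_d X (fun m => ModuleCat.ofHom (δ m)) m)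

/-- The chain map with given components. -/
def homMk {X Y : ChainComplex (ModuleCat.{u} R) ℕ} (f : ∀ m, X.X m →ₗ[R] Y.X m)
    (hf : ∀ m x, f m (del X m x) = del Y m (f (m + 1) x)) : X ⟶ Y where
  f m := ModuleCat.ofHom (f m)
  comm' := by
    rintro _ j rfl
    exact ModuleCat.hom_ext (LinearMap.ext fun x => (hf j x).symm)

theorem hom_ext {X Y : ChainComplex (ModuleCat.{u} R) ℕ} {φ ψ : X ⟶ Y}
    (h : ∀ m x, app φ m x = app ψ m x) : φ = ψ :=
  HomologicalComplex.hom_ext _ _ fun m => ModuleCat.hom_ext (LinearMap.ext (h m))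

theorem acyclic_iff (X : ChainComplex (ModuleCat.{u} R) ℕ) :
    X.Acyclic ↔ Function.Surjective (del X 0) ∧
      ∀ m x, del X m x = 0 → ∃ y, del X (m + 1) y = x := by
  have key : ∀ q, X.ExactAt q ↔ ∀ x, (X.d q (q - 1)).hom x = 0 → ∃ y, del X q y = x := by
    intro q
    rw [HomologicalComplex.exactAt_iff' _ (q + 1) q (q - 1) (by simp) (by cases q <;> simp),
      ShortComplex.ShortExact.moduleCat_exact_iff_function_exact]
    refine ⟨fun h x hx => (h x).1 hx, fun h x => ⟨h x, ?_⟩⟩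
    rintro ⟨y, rfl⟩
    exact congrArg (fun f : X.X (q + 1) ⟶ X.X (q - 1) => f.hom y) (X.d_comp_d _ _ _)
  constructor
  · intro h
    refine ⟨fun x => (key 0).1 (h 0) x ?_, fun m x hx => (key (m + 1)).1 (h (m + 1)) x hx⟩
    rw [X.shape _ _ (by simp)]
    rfl
  · rintro ⟨h0, h1⟩ (_ | m)
    · exact (key 0).2 fun x _ => h0 x
    · exact (key (m + 1)).2 (h1 m)

/-- Short exactness of a sequence of complexes, in terms of elements. -/
structure IsShortExact {X' X X'' : ChainComplex (ModuleCat.{u} R) ℕ} (f : X' ⟶ X) (g : X ⟶ X'') :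
    Prop where
  inj : ∀ m, Function.Injective (app f m)
  comp : ∀ m x, app g m (app f m x) = 0
  exact : ∀ m x, app g m x = 0 → ∃ y, app f m y = x
  surj : ∀ m, Function.Surjective (app g m)

theorem IsShortExact.shortExact {X' X X'' : ChainComplex (ModuleCat.{u} R) ℕ} {f : X' ⟶ X}
    {g : X ⟶ X''} (h : IsShortExact f g) :
    ∃ h : f ≫ g = 0, (ShortComplex.mk f g h).ShortExact := by
  refine ⟨hom_ext h.comp, HomologicalComplex.shortExact_of_degreewise_shortExact _ fun m => ?_⟩
  refine { exact := ?_, mono_f := ?_, epi_g := ?_ }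
  · rw [ShortComplex.ShortExact.moduleCat_exact_iff_function_exact]
    exact fun x => ⟨h.exact m x, by rintro ⟨y, rfl⟩; exact h.comp m y⟩
  · exact (ModuleCat.mono_iff_injective _).2 (h.inj m)
  · exact (ModuleCat.epi_iff_surjective _).2 (h.surj m)

theorem isShortExact_of_shortExact {X' X X'' : ChainComplex (ModuleCat.{u} R) ℕ} {f : X' ⟶ X}
    {g : X ⟶ X''} {w : f ≫ g = 0} (h : (ShortComplex.mk f g w).ShortExact) :
    IsShortExact f g := by
  have hm : ∀ m, (ShortComplex.mk (f.f m) (g.f m)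
      (by rw [← HomologicalComplex.comp_f, w]; rfl)).ShortExact := fun m =>
    h.map_of_exact (HomologicalComplex.eval _ _ m)
  have he := fun m => (ShortComplex.ShortExact.moduleCat_exact_iff_function_exact _).1 (hm m).exact
  exact
    { inj := fun m => (ModuleCat.mono_iff_injective _).1 (hm m).mono_f
      comp := fun m x => (he m _).2 ⟨x, rfl⟩
      exact := fun m x hx => (he m x).1 hx
      surj := fun m => (ModuleCat.epi_iff_surjective _).1 (hm m).epi_g }

/-- The zero complex. -/
abbrev zero : ChainComplex (ModuleCat.{u} R) ℕ :=
  ofDel (fun _ => ModuleCat.of R PUnit) 0 (fun _ _ => rfl)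

theorem isZero_zero : IsZero (zero (R := R)) := by
  refine (IsZero.iff_id_eq_zero _).2 (hom_ext fun m x => ?_)
  exact Subsingleton.elim (α := PUnit) _ _

theorem isPerf_zero (n : ℕ∞) : IsPerf n (zero (R := R)) := by
  have h : ∀ i, IsZero ((zero (R := R)).X i) := fun i =>
    ModuleCat.isZero_of_subsingleton (ModuleCat.of R PUnit)
  exact ⟨fun i => ⟨inferInstanceAs (Module.Finite R PUnit.{u + 1}),
    inferInstanceAs (Module.Projective R PUnit.{u + 1})⟩, ⟨0, fun i _ => h i⟩, fun i _ => h i⟩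

/-- The degreewise direct sum of two complexes. -/
abbrev prod (X Y : ChainComplex (ModuleCat.{u} R) ℕ) : ChainComplex (ModuleCat.{u} R) ℕ :=
  ofDel (fun m => ModuleCat.of R (X.X m × Y.X m)) (fun m => (del X m).prodMap (del Y m))
    (fun m x => Prod.ext (del_del X m x.1) (del_del Y m x.2))

theorem del_prod (X Y : ChainComplex (ModuleCat.{u} R) ℕ) (m : ℕ) (x : X.X (m + 1) × Y.X (m + 1)) :
    del (prod X Y) m x = ((del X m x.1, del Y m x.2) : X.X m × Y.X m) := by
  rw [del_ofDel]
  rfl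

theorem isPerf_prod {n : ℕ∞} {X Y : ChainComplex (ModuleCat.{u} R) ℕ} (hX : IsPerf n X)
    (hY : IsPerf n Y) : IsPerf n (prod X Y) := by
  have h : ∀ i, IsZero (X.X i) → IsZero (Y.X i) → IsZero ((prod X Y).X i) := by
    intro i h1 h2
    rw [ModuleCat.isZero_iff_subsingleton] at h1 h2 ⊢
    exact inferInstanceAs (Subsingleton (X.X i × Y.X i))
  obtain ⟨h1, ⟨N, hN⟩, h2⟩ := hX
  obtain ⟨h1', ⟨N', hN'⟩, h2'⟩ := hY
  refine ⟨fun i => ?_, ⟨max N N', fun i hi => h i (hN i ?_) (hN' i ?_)⟩,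
    fun i hi => h i (h2 i hi) (h2' i hi)⟩
  · have := (h1 i).1
    have := (h1 i).2
    have := (h1' i).1
    have := (h1' i).2
    exact ⟨inferInstanceAs (Module.Finite R (X.X i × Y.X i)),
      inferInstanceAs (Module.Projective R (X.X i × Y.X i))⟩
  · omega
  · omega

end ModCx

/-! ### Modules over `T_s` as complexes with homotopies -/

namespace ModCx

variable {R : Type u} [CommRing R]

/-- `h` is a homotopy from multiplication by `s` on `X` to zero: `d h + h d = s`. -/
structure IsNullhtpy (X : ChainComplex (ModuleCat.{u} R) ℕ) (s : R)
    (h : ∀ m, X.X m →ₗ[R] X.X (m + 1)) : Prop where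
  zero : ∀ x, del X 0 (h 0 x) = s • x
  succ : ∀ m x, del X (m + 1) (h (m + 1) x) + h m (del X m x) = s • x

theorem IsNullhtpy.smul {X : ChainComplex (ModuleCat.{u} R) ℕ} {s : R}
    {h : ∀ m, X.X m →ₗ[R] X.X (m + 1)} (hh : IsNullhtpy X s h) {t u : R} (hu : s * t = u) :
    IsNullhtpy X u (fun m => t • h m) where
  zero x := by
    rw [LinearMap.smul_apply, map_smul, hh.zero, smul_smul, mul_comm, hu]
  succ m x := by
    rw [LinearMap.smul_apply, map_smul, LinearMap.smul_apply, ← smul_add, hh.succ, smul_smul,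
      mul_comm, hu]

end ModCx

/-- A `T_s`-module, presented as a complex `X` with homotopies `eᵢ` from multiplication by `sᵢ` to
zero. Since `T_s` is free, the `eᵢ` need not satisfy any other relation. For distinct `s` and `u`,
the underlying complexes of a `T_s`-module and of a `T_u`-module can be compared without unfolding
the free algebra, in contrast to the dg-modules of `DGModule`. -/
structure TMod {R : Type u} [CommRing R] {d : ℕ} (s : Fin d → R) where
  /-- the underlying chain complex -/
  cx : ChainComplex (ModuleCat.{u} R) ℕ
  /-- the action of the generators -/
  e : Fin d → ∀ m, cx.X m →ₗ[R] cx.X (m + 1)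
  isNullhtpy : ∀ i, ModCx.IsNullhtpy cx (s i) (e i)

namespace TMod

open ModCx

variable {R : Type u} [CommRing R] {d : ℕ} {s : Fin d → R}

/-- The homotopies given by the generators of `T_s` on a dg-module. -/
noncomputable abbrev ofDG (X : DGModule (TDGA s)) : TMod s where
  cx := X.cx
  e i m := X.act m (m + 1) (FreeAlgebra.ι R i)
  isNullhtpy i := by
    have h1 : (TDGA s).d (FreeAlgebra.ι R i) = s i • (1 : (TDGA s).carrier) :=
      (FreeDGA.diff_ι s i).trans (Algebra.algebraMap_eq_smul_one _)
    constructor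
    · intro x
      have h := X.leibniz 1 0 0 (FreeAlgebra.ι R i) (FreeDGA.ι_mem i) x
      have h0 : (X.cx.d 0 (0 - 1)).hom x = 0 := by
        rw [X.cx.shape _ _ (by simp)]; rfl
      rw [h1, map_smul, LinearMap.smul_apply, X.act_one, h0, map_zero, smul_zero, add_zero] at h
      exact h
    · intro m x
      have h := X.leibniz 1 (m + 1) (m + 1) (FreeAlgebra.ι R i) (FreeDGA.ι_mem i) x
      rw [h1, map_smul, LinearMap.smul_apply, X.act_one, pow_one, neg_one_smul] at h
      exact add_eq_of_eq_add_neg h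

section construct

variable (X : ChainComplex (ModuleCat.{u} R) ℕ) (h : Fin d → ∀ m, X.X m →ₗ[R] X.X (m + 1))

/-- The action of the free algebra on `∏ Xₘ` in which `eᵢ` acts by `hᵢ`. -/
noncomputable def action : FreeAlgebra R (Fin d) →ₐ[R] Module.End R (∀ m, X.X m) :=
  FreeAlgebra.lift R fun i => LinearMap.pi fun m => match m with
    | 0 => 0
    | m + 1 => h i m ∘ₗ LinearMap.proj m

theorem action_single (i : Fin d) (q : ℕ) (x : X.X q) :
    action X h (FreeAlgebra.ι R i) (Pi.single q x) = Pi.single (q + 1) (h i q x) := by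
  rw [action, FreeAlgebra.lift_ι_apply]
  funext m
  rcases m with _ | m
  · exact (Pi.single_eq_of_ne (M := fun m => X.X m) (Nat.succ_ne_zero q).symm _).symm
  · change h i m (Pi.single (M := fun m => X.X m) q x m) = _
    by_cases hm : m = q
    · subst hm
      rw [Pi.single_eq_same, Pi.single_eq_same]
    · rw [Pi.single_eq_of_ne hm, Pi.single_eq_of_ne (by omega), map_zero]

/-- Elements of degree `p` of the free algebra map the factor `X_q` to the factor `X_{p+q}`. -/
theorem action_homogeneous (p : ℕ) (a : FreeAlgebra R (Fin d)) (ha : a ∈ FreeDGA.deg R d p) :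
    ∀ (q : ℕ) (x : X.X q), ∃ (r : ℕ) (y : X.X r), r = p + q ∧
      action X h a (Pi.single q x) = Pi.single r y := by
  induction ha using Submodule.pow_induction_on_left' with
  | algebraMap c =>
    intro q x
    refine ⟨q, c • x, (zero_add q).symm, ?_⟩
    rw [AlgHom.commutes, Module.algebraMap_end_apply, Pi.single_smul]
  | add a b p ha hb iha ihb =>
    intro q x
    obtain ⟨r, y, rfl, hy⟩ := iha q x
    obtain ⟨_, z, rfl, hz⟩ := ihb q x
    exact ⟨_, y + z, rfl, by rw [map_add, LinearMap.add_apply, hy, hz, Pi.single_add]⟩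
  | mem_mul m hm p a ha ih =>
    intro q x
    obtain ⟨r, y, rfl, hy⟩ := ih q x
    rw [map_mul, Module.End.mul_apply, hy]
    suffices ∃ z : X.X (p + q + 1), action X h m (Pi.single (p + q) y) =
        Pi.single (M := fun m => X.X m) (p + q + 1) z by
      obtain ⟨z, hz⟩ := this
      exact ⟨_, z, by omega, hz⟩
    clear ih hy
    induction hm using Submodule.span_induction with
    | mem a ha =>
      obtain ⟨i, rfl⟩ := ha
      exact ⟨_, action_single X h i _ y⟩
    | zero => exact ⟨0, by rw [map_zero, LinearMap.zero_apply, Pi.single_zero]⟩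
    | add a b _ _ ha hb =>
      obtain ⟨z, hz⟩ := ha
      obtain ⟨w, hw⟩ := hb
      exact ⟨z + w, by rw [map_add, LinearMap.add_apply, hz, hw, Pi.single_add]⟩
    | smul c a _ ha =>
      obtain ⟨z, hz⟩ := ha
      exact ⟨c • z, by rw [map_smul, LinearMap.smul_apply, hz, Pi.single_smul]⟩

theorem action_deg {p : ℕ} {a : FreeAlgebra R (Fin d)} (ha : a ∈ FreeDGA.deg R d p) (q : ℕ)
    (x : X.X q) : action X h a (Pi.single q x) =
      Pi.single (p + q) (action X h a (Pi.single q x) (p + q)) := by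
  obtain ⟨_, y, rfl, hy⟩ := action_homogeneous X h p a ha q x
  rw [hy, Pi.single_eq_same]

/-- The differential of `X` as an endomorphism of `∏ Xₘ`. -/
def totalDel : Module.End R (∀ m, X.X m) :=
  LinearMap.pi fun m => del X m ∘ₗ LinearMap.proj (m + 1)

theorem totalDel_single (q : ℕ) (x : X.X q) :
    totalDel X (Pi.single q x) = Pi.single (q - 1) ((X.d q (q - 1)).hom x) := by
  funext m
  change del X m (Pi.single (M := fun m => X.X m) q x (m + 1)) = _
  by_cases hq : q = m + 1
  · subst hq
    rw [Pi.single_eq_same]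
    exact (Pi.single_eq_same (M := fun m => X.X m) m _).symm
  · rw [Pi.single_eq_of_ne (Ne.symm hq), map_zero]
    rcases q with _ | q
    · have h0 : (X.d 0 (0 - 1)).hom x = 0 := by
        rw [X.shape _ _ (by simp)]; rfl
      rw [h0, Pi.single_zero]; rfl
    · exact (Pi.single_eq_of_ne (M := fun m => X.X m) (by omega : m ≠ q) _).symm

theorem totalDel_action_ι {i : Fin d} (hh : IsNullhtpy X (s i) (h i)) :
    totalDel X * action X h (FreeAlgebra.ι R i) + action X h (FreeAlgebra.ι R i) * totalDel X =
      algebraMap R _ (s i) := by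
  refine LinearMap.ext fun x => funext fun m => ?_
  rw [action, FreeAlgebra.lift_ι_apply]
  rcases m with _ | m
  · exact (add_zero _).trans (hh.zero (x 0))
  · exact hh.succ m (x (m + 1))

/-- The Leibniz rule for the action on `∏ Xₘ`. -/
theorem totalDel_action (hh : ∀ i, IsNullhtpy X (s i) (h i)) (p : ℕ)
    (a : FreeAlgebra R (Fin d)) (ha : a ∈ FreeDGA.deg R d p) :
    totalDel X * action X h a =
      action X h (FreeDGA.diff s a) + (-1 : R) ^ p • (action X h a * totalDel X) := by
  induction ha using Submodule.pow_induction_on_left' with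
  | algebraMap c =>
    rw [FreeDGA.diff_algebraMap, AlgHom.commutes, map_zero, zero_add, pow_zero, one_smul]
    exact (Algebra.commutes c (totalDel X)).symm
  | add a b p ha hb iha ihb => simp only [map_add, mul_add, add_mul, iha, ihb, smul_add]; abel
  | mem_mul m hm p a ha ih =>
    have hm1 : m ∈ FreeDGA.deg R d 1 := by rwa [FreeDGA.deg, pow_one]
    have key : totalDel X * action X h m =
        action X h (FreeDGA.diff s m) - action X h m * totalDel X := by
      clear ih hm1
      induction hm using Submodule.span_induction with
      | mem a ha =>
        obtain ⟨i, rfl⟩ := ha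
        rw [FreeDGA.diff_ι, AlgHom.commutes, ← totalDel_action_ι X h (hh i), add_sub_cancel_right]
      | zero => simp
      | add a b _ _ ha hb => simp only [map_add, mul_add, add_mul, ha, hb]; abel
      | smul c a _ ha => simp only [map_smul, mul_smul_comm, smul_mul_assoc, ha, smul_sub]
    have hneg : ∀ (c : R) (z : Module.End R (∀ m, X.X m)), -c • z = -(c • z) := fun c z =>
      neg_smul c z
    rw [FreeDGA.diff_mul s 1 m hm1, map_mul, ← mul_assoc, key, sub_mul, mul_assoc, ih, map_add,
      map_mul, map_smul, map_mul, pow_one, Nat.succ_eq_add_one, pow_succ, mul_neg_one, hneg, hneg,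
      one_smul, mul_add, mul_smul_comm, mul_assoc]
    abel

end construct

/-- The dg-module over `T_s` given by a complex with homotopies. -/
noncomputable abbrev toDG (X : TMod s) : DGModule (TDGA s) where
  cx := X.cx
  act q r := ((LinearMap.lcomp R (X.cx.X r) (LinearMap.single R (fun m => X.cx.X m) q)) ∘ₗ
    LinearMap.compRight R (LinearMap.proj r)) ∘ₗ (action X.cx X.e).toLinearMap
  act_deg p q r hr a ha := by
    ext x
    change action X.cx X.e a (Pi.single q x) r = 0
    rw [action_deg X.cx X.e ha, Pi.single_eq_of_ne (Ne.symm hr)]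
  act_one q x := by
    change action X.cx X.e 1 (Pi.single q x) q = x
    rw [map_one, Module.End.one_apply, Pi.single_eq_same]
  act_mul p q r a b hb x := by
    change action X.cx X.e (a * b) (Pi.single q x) r =
      action X.cx X.e a (Pi.single (p + q) (action X.cx X.e b (Pi.single q x) (p + q))) r
    rw [map_mul, Module.End.mul_apply, ← action_deg X.cx X.e hb]
  leibniz p q r a ha x := by
    have h1 := congrFun (LinearMap.congr_fun (totalDel_action X.cx X.e X.isNullhtpy p a ha)
      (Pi.single q x)) r
    refine h1.trans ?_
    change action X.cx X.e (FreeDGA.diff s a) (Pi.single q x) r +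
      (-1 : R) ^ p • action X.cx X.e a (totalDel X.cx (Pi.single q x)) r = _
    rw [totalDel_single]
    rfl

theorem toDG_act_ι (X : TMod s) (i : Fin d) (m : ℕ) (x : X.cx.X m) :
    X.toDG.act m (m + 1) (FreeAlgebra.ι R i) x = e X i m x := by
  change action X.cx X.e (FreeAlgebra.ι R i) (Pi.single m x) (m + 1) = X.e i m x
  rw [action_single, Pi.single_eq_same]

/-- A chain map that commutes with the action of the generators commutes with all of `T_s`. -/
theorem map_act {X Y : DGModule (TDGA s)} (φ : X.cx ⟶ Y.cx) 
    (hφ : ∀ i m x, app φ (m + 1) (X.act m (m + 1) (FreeAlgebra.ι R i) x) =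
      Y.act m (m + 1) (FreeAlgebra.ι R i) (app φ m x))
    (q r : ℕ) (a : (TDGA s).carrier) (x : X.cx.X q) :
    app φ r (X.act q r a x) = Y.act q r a (app φ q x) := by
  have key : ∀ p, ∀ a ∈ FreeDGA.deg R d p, ∀ (q r : ℕ) (x : X.cx.X q),
      app φ r (X.act q r a x) = Y.act q r a (app φ q x) := by
    intro p a ha
    induction ha using Submodule.pow_induction_on_left' with
    | algebraMap c =>
      intro q r x
      have hc : algebraMap R (FreeAlgebra R (Fin d)) c = c • (1 : (TDGA s).carrier) :=
        Algebra.algebraMap_eq_smul_one _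
      have h1 : (1 : (TDGA s).carrier) ∈ (TDGA s).deg 0 := SetLike.GradedOne.one_mem
      rw [hc, map_smul, map_smul, LinearMap.smul_apply, LinearMap.smul_apply, map_smul]
      congr 1
      by_cases hr : 0 + q = r
      · obtain rfl : q = r := by omega
        rw [X.act_one, Y.act_one]
      · rw [X.act_deg 0 q r hr _ h1, Y.act_deg 0 q r hr _ h1]
        exact map_zero _
    | add a b p ha hb iha ihb =>
      intro q r x
      rw [map_add, map_add, LinearMap.add_apply, LinearMap.add_apply, map_add, iha, ihb]
    | mem_mul m hm p a ha ih =>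
      intro q r x
      rw [X.act_mul p q r m a ha, Y.act_mul p q r m a ha, ← ih]
      generalize X.act q (p + q) a x = y
      clear ih
      induction hm using Submodule.span_induction with
      | mem a ha =>
        obtain ⟨i, rfl⟩ := ha
        by_cases hr : 1 + (p + q) = r
        · obtain rfl : p + q + 1 = r := by omega
          exact hφ i _ y
        · rw [X.act_deg 1 _ r hr _ (FreeDGA.ι_mem i), Y.act_deg 1 _ r hr _ (FreeDGA.ι_mem i)]
          exact map_zero _
      | zero => rw [map_zero, map_zero]; exact map_zero _
      | add a b _ _ ha hb =>
        rw [map_add, map_add, LinearMap.add_apply, LinearMap.add_apply, map_add, ha, hb]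
      | smul c a _ ha =>
        rw [map_smul, map_smul, LinearMap.smul_apply, LinearMap.smul_apply, map_smul, ha]
  induction a using DirectSum.Decomposition.inductionOn (FreeDGA.deg R d) with
  | zero => rw [map_zero, map_zero]; exact map_zero _
  | homogeneous a => exact key _ _ a.2 q r x
  | add a b ha hb =>
    rw [map_add, map_add, LinearMap.add_apply, LinearMap.add_apply, map_add, ha, hb]

/-- A chain map between `T_s`-modules that commutes with the action of the generators. -/
abbrev IsEquivariant {X Y : TMod s} (φ : X.cx ⟶ Y.cx) : Prop :=
  ∀ i m x, app φ (m + 1) (e X i m x) = e Y i m (app φ m x)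

theorem hasShortExact {X' X X'' : TMod s} {f : X'.cx ⟶ X.cx} {g : X.cx ⟶ X''.cx}
    (hf : IsEquivariant f) (hg : IsEquivariant g) (h : IsShortExact f g) :
    GrothGrp.HasShortExact (DGModule.forget (TDGA s)) X'.toDG X.toDG X''.toDG :=
  ⟨⟨f, map_act (X := X'.toDG) (Y := X.toDG) f fun i m x => by
      rw [toDG_act_ι, toDG_act_ι, hf]⟩,
    ⟨g, map_act (X := X.toDG) (Y := X''.toDG) g fun i m x => by
      rw [toDG_act_ι, toDG_act_ι, hg]⟩, h.shortExact⟩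

/-- Restriction of scalars along `T_u ⟶ T_s`, `eᵢ ↦ tᵢ eᵢ`, where `u = s t`. -/
abbrev res {t u : Fin d → R} (hu : ∀ i, s i * t i = u i) (X : TMod s) : TMod u where
  cx := X.cx
  e i m := t i • X.e i m
  isNullhtpy i := (X.isNullhtpy i).smul (hu i)

theorem IsEquivariant.res {t u : Fin d → R} (hu : ∀ i, s i * t i = u i) {X Y : TMod s}
    {φ : X.cx ⟶ Y.cx} (hφ : IsEquivariant φ) :
    IsEquivariant (X := res hu X) (Y := res hu Y) φ := fun i m x => by
  rw [LinearMap.smul_apply, LinearMap.smul_apply, ← hφ, map_smul]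

/-- The zero module. -/
abbrev zero (s : Fin d → R) : TMod s :=
  mk ModCx.zero 0 fun _ => ⟨fun _ => rfl, fun _ _ => rfl⟩

/-- The direct sum of two `T_s`-modules. -/
abbrev prod (X Y : TMod s) : TMod s :=
  mk (ModCx.prod X.cx Y.cx) (fun i m => (e X i m).prodMap (e Y i m)) fun i =>
    { zero := fun x => by
        rw [del_prod]
        exact Prod.ext ((isNullhtpy X i).zero x.1) ((isNullhtpy Y i).zero x.2)
      succ := fun m x => by
        rw [del_prod, del_prod]
        exact Prod.ext ((isNullhtpy X i).succ m x.1) ((isNullhtpy Y i).succ m x.2) }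

end TMod

/-! ### Homotopy fibres of chain maps -/

namespace ModCx

variable {R : Type u} [CommRing R]

/-- The map `s h - h e`, which corrects a homotopy `h` from `s + e` to zero. -/
def correct {X : ChainComplex (ModuleCat.{u} R) ℕ} (s : R) (h : ∀ m, X.X m →ₗ[R] X.X (m + 1))
    (e : ∀ m, X.X m →ₗ[R] X.X m) (m : ℕ) : X.X m →ₗ[R] X.X (m + 1) :=
  s • h m - h m ∘ₗ e m

/-- If `d h + h d = s + e` with `e² = 0`, then `e` commutes with `d`, and `s h - h e` is a homotopy
from `(s + e) (s - e) = s²` to zero. -/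
theorem isNullhtpy_correct {X : ChainComplex (ModuleCat.{u} R) ℕ} {s u : R} (hu : s * s = u)
    {h : ∀ m, X.X m →ₗ[R] X.X (m + 1)} {e : ∀ m, X.X m →ₗ[R] X.X m}
    (h0 : ∀ x, del X 0 (h 0 x) = s • x + e 0 x)
    (h1 : ∀ m x, del X (m + 1) (h (m + 1) x) + h m (del X m x) = s • x + e (m + 1) x)
    (he : ∀ m x, e m (e m x) = 0) : IsNullhtpy X u (correct s h e) := by
  have hd : ∀ m x, del X m (e (m + 1) x) = e m (del X m x) := by
    intro m x
    have key : del X m (h m (del X m x)) = s • del X m x + del X m (e (m + 1) x) := by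
      have := congrArg (del X m) (h1 m x)
      rwa [map_add, del_del, zero_add, map_add, map_smul] at this
    refine add_left_cancel (a := s • del X m x) ?_
    rw [← key]
    rcases m with _ | m
    · exact h0 _
    · rw [← h1, del_del, map_zero, add_zero]
  constructor
  · intro x
    simp only [correct, LinearMap.sub_apply, LinearMap.smul_apply, LinearMap.comp_apply, map_sub,
      map_smul, h0, he, smul_add, smul_smul, hu]
    abel
  · intro m x
    have h2 := h1 m (e (m + 1) x)
    rw [he, add_zero, hd] at h2
    have h3 := h1 m x
    have : ∀ a b c f : X.X (m + 1), s • a - b + (s • c - f) = s • (a + c) - (b + f) := by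
      intro a b c f
      rw [smul_add]; abel
    simp only [correct, LinearMap.sub_apply, LinearMap.smul_apply, LinearMap.comp_apply, map_sub,
      map_smul]
    rw [this, h2, h3, smul_add, smul_smul, hu, add_sub_cancel_right]

variable {A B A' B' A'' B'' : ChainComplex (ModuleCat.{u} R) ℕ}

/-- The terms of the homotopy fibre of `φ : A ⟶ B`, truncated to nonnegative degrees:
`A_m × B_{m+1}` for `m > 0`, and the submodule of all `(a, b)` with `φ a = d b` for `m = 0`. -/
def fibSub (φ : A ⟶ B) (m : ℕ) : Submodule R (A.X m × B.X (m + 1)) where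
  carrier := {x | m = 0 → app φ m x.1 = del B m x.2}
  add_mem' {x y} hx hy hm := by
    rw [Prod.fst_add, Prod.snd_add, map_add, map_add, hx hm, hy hm]
  zero_mem' _ := by rw [Prod.fst_zero, Prod.snd_zero, map_zero, map_zero]
  smul_mem' c x hx hm := by rw [Prod.smul_fst, Prod.smul_snd, map_smul, map_smul, hx hm]

/-- The differential `(a, b) ↦ (d a, φ a - d b)` of the homotopy fibre. -/
def fibDel (φ : A ⟶ B) (m : ℕ) : fibSub φ (m + 1) →ₗ[R] fibSub φ m :=
  LinearMap.codRestrict (fibSub φ m)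
    (((del A m ∘ₗ LinearMap.fst R _ _).prod
      (app φ (m + 1) ∘ₗ LinearMap.fst R _ _ - del B (m + 1) ∘ₗ LinearMap.snd R _ _)) ∘ₗ
        (fibSub φ (m + 1)).subtype)
    (fun x _ => by
      change app φ m (del A m x.1.1) = del B m (app φ (m + 1) x.1.1 - del B (m + 1) x.1.2)
      rw [map_sub, del_del, sub_zero, app_del])

/-- The homotopy fibre of `φ : A ⟶ B`, truncated to nonnegative degrees. -/
abbrev fib (φ : A ⟶ B) : ChainComplex (ModuleCat.{u} R) ℕ :=
  ofDel (fun m => ModuleCat.of R (fibSub φ m)) (fibDel φ) (fun m x => Subtype.ext (by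
    change (del A m (del A (m + 1) x.1.1), app φ (m + 1) (del A (m + 1) x.1.1) -
      del B (m + 1) (app φ (m + 2) x.1.1 - del B (m + 2) x.1.2)) = (0, 0)
    rw [del_del, map_sub, del_del, sub_zero, app_del, sub_self]))

theorem del_fib (φ : A ⟶ B) (m : ℕ) (x : fibSub φ (m + 1)) :
    (del (fib φ) m x : fibSub φ m) = fibDel φ m x := by
  rw [del_ofDel]

/-- The map of homotopy fibres induced by a commutative square. -/
def fibMap (φ' : A' ⟶ B') (φ : A ⟶ B) (α : A' ⟶ A) (β : B' ⟶ B) (h : α ≫ φ = φ' ≫ β) :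
    fib φ' ⟶ fib φ :=
  have h1 : ∀ m x, app φ m (app α m x) = app β m (app φ' m x) := fun m x =>
    congrArg (fun f => app f m x) h
  homMk (X := fib φ') (Y := fib φ)
    (fun m => LinearMap.restrict ((app α m).prodMap (app β (m + 1))) (p := fibSub φ' m)
      (q := fibSub φ m) (fun x hx hm => by
        change app φ m (app α m x.1) = del B m (app β (m + 1) x.2)
        rw [h1, hx hm, app_del]))
    (fun m x => Subtype.ext (by
      rw [del_fib, del_fib]
      change (app α m (del A' m x.1.1),
          app β (m + 1) (app φ' (m + 1) x.1.1 - del B' (m + 1) x.1.2)) =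
        (del A m (app α (m + 1) x.1.1), app φ (m + 1) (app α (m + 1) x.1.1) -
          del B (m + 1) (app β (m + 2) x.1.2))
      rw [map_sub, h1, app_del, app_del]))

theorem fibMap_app (φ' : A' ⟶ B') (φ : A ⟶ B) (α : A' ⟶ A) (β : B' ⟶ B) (h : α ≫ φ = φ' ≫ β)
    (m : ℕ) (x : fibSub φ' m) :
    (app (fibMap φ' φ α β h) m x : fibSub φ m).1 = (app α m x.1.1, app β (m + 1) x.1.2) := rfl

/-- The projection of the homotopy fibre of `φ : A ⟶ B` to `A`. -/
def fibFst (φ : A ⟶ B) : fib φ ⟶ A :=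
  homMk (X := fib φ) (fun m => LinearMap.fst R _ _ ∘ₗ (fibSub φ m).subtype)
    (fun m x => by rw [del_fib]; rfl)

/-- The condition `H₀(φ)` is onto: every element of `B₀` is of the form `φ a + d b`. -/
def H0Surj (φ : A ⟶ B) : Prop := ∀ y : B.X 0, ∃ a b, app φ 0 a + del B 0 b = y

theorem H0Surj.of_surjective {φ : A ⟶ B} (h : Function.Surjective (app φ 0)) : H0Surj φ :=
  fun y => (h y).elim fun a ha => ⟨a, 0, by rw [ha, map_zero, add_zero]⟩

theorem H0Surj.of_acyclic (φ : A ⟶ B) (h : B.Acyclic) : H0Surj φ :=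
  fun y => (((acyclic_iff B).1 h).1 y).elim fun b hb => ⟨0, b, by rw [hb, map_zero, zero_add]⟩

/-- The homotopy fibre is exact in the chain map. In degree zero this is the snake lemma for the
maps `A₀ × B₁ → B₀`, the first of which is onto. -/
theorem isShortExact_fibMap {φ' : A' ⟶ B'} {φ : A ⟶ B} {φ'' : A'' ⟶ B''} {α : A' ⟶ A}
    {α' : A ⟶ A''} {β : B' ⟶ B} {β' : B ⟶ B''} (hα : IsShortExact α α') (hβ : IsShortExact β β')
    (h : α ≫ φ = φ' ≫ β) (h' : α' ≫ φ'' = φ ≫ β') (hφ' : H0Surj φ') :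
    IsShortExact (fibMap φ' φ α β h) (fibMap φ φ'' α' β' h') where
  inj m x y hxy := by
    have h0 := congrArg Subtype.val hxy
    rw [fibMap_app, fibMap_app, Prod.mk.injEq] at h0
    exact Subtype.ext (Prod.ext (hα.inj m h0.1) (hβ.inj (m + 1) h0.2))
  comp m x := Subtype.ext (Prod.ext (hα.comp m x.1.1) (hβ.comp (m + 1) x.1.2))
  exact m x hx := by
    have h0 := congrArg Subtype.val hx
    rw [fibMap_app] at h0
    obtain ⟨a, ha⟩ := hα.exact m x.1.1 (congrArg Prod.fst h0)
    obtain ⟨b, hb⟩ := hβ.exact (m + 1) x.1.2 (congrArg Prod.snd h0)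
    refine ⟨⟨(a, b), fun hm => hβ.inj m ?_⟩, Subtype.ext (Prod.ext ha hb)⟩
    have h1 : app β m (app φ' m a) = app φ m (app α m a) :=
      (congrArg (fun f => app f m a) h).symm
    rw [h1, app_del, hb, ha]
    exact x.2 hm
  surj m x := by
    obtain ⟨⟨a'', b''⟩, hx⟩ := x
    obtain ⟨a, ha⟩ := hα.surj m a''
    obtain ⟨b, hb⟩ := hβ.surj (m + 1) b''
    rcases m with _ | m
    · have h1 : app β' 0 (app φ 0 a - del B 0 b) = 0 := by
        have h2 : app β' 0 (app φ 0 a) = app φ'' 0 (app α' 0 a) :=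
          (congrArg (fun f => app f 0 a) h').symm
        rw [map_sub, h2, ha, app_del, hb, sub_eq_zero]
        exact hx rfl
      obtain ⟨y, hy⟩ := hβ.exact 0 _ h1
      obtain ⟨a', b', hab⟩ := hφ' y
      have h3 : app β 0 (app φ' 0 a') = app φ 0 (app α 0 a') :=
        (congrArg (fun f => app f 0 a') h).symm
      have h4 : app φ 0 (app α 0 a') + del B 0 (app β 1 b') = app φ 0 a - del B 0 b := by
        rw [← hy, ← hab, map_add, h3, app_del]
      refine ⟨⟨(a - app α 0 a', b + app β 1 b'), fun _ => ?_⟩, Subtype.ext (Prod.ext ?_ ?_)⟩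
      · change app φ 0 (a - app α 0 a') = del B 0 (b + app β 1 b')
        rw [map_sub, map_add, sub_eq_iff_eq_add.1 h4.symm]
        abel
      · change app α' 0 (a - app α 0 a') = a''
        rw [map_sub, hα.comp, sub_zero, ha]
      · change app β' 1 (b + app β 1 b') = b''
        rw [map_add, hβ.comp, add_zero, hb]
    · exact ⟨⟨(a, b), fun hm => absurd hm (Nat.succ_ne_zero m)⟩, Subtype.ext (Prod.ext ha hb)⟩

/-- The case `B'' = 0` of `isShortExact_fibMap`, where the fibre of `A'' ⟶ 0` is identified with
`A''`. -/
theorem isShortExact_fibFst {φ : A ⟶ B} {α : A' ⟶ A} {γ : A ⟶ A''} (hα : IsShortExact α γ)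
    (hφ : H0Surj (α ≫ φ)) :
    IsShortExact (fibMap (α ≫ φ) φ α (𝟙 B) (Category.comp_id _).symm) (fibFst φ ≫ γ) where
  inj m x y hxy := by
    have h0 := congrArg Subtype.val hxy
    rw [fibMap_app, fibMap_app, Prod.mk.injEq] at h0
    exact Subtype.ext (Prod.ext (hα.inj m h0.1) h0.2)
  comp m x := hα.comp m x.1.1
  exact m x hx := by
    obtain ⟨a, ha⟩ := hα.exact m x.1.1 hx
    refine ⟨⟨(a, x.1.2), fun hm => ?_⟩, Subtype.ext (Prod.ext ha rfl)⟩
    change app φ m (app α m a) = _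
    rw [ha]
    exact x.2 hm
  surj m x := by
    obtain ⟨a, ha⟩ := hα.surj m x
    rcases m with _ | m
    · obtain ⟨a', b, hab⟩ := hφ (app φ 0 a)
      refine ⟨⟨(a - app α 0 a', b), fun _ => ?_⟩, ?_⟩
      · change app φ 0 (a - app α 0 a') = del B 0 b
        rw [map_sub, sub_eq_iff_eq_add, add_comm]
        exact hab.symm
      · change app γ 0 (a - app α 0 a') = x
        rw [map_sub, hα.comp, sub_zero, ha]
    · exact ⟨⟨(a, 0), fun hm => absurd hm (Nat.succ_ne_zero m)⟩, ha⟩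

theorem acyclic_fib {φ : A ⟶ B} (hφ : ∀ m, Function.Bijective (app φ m)) : (fib φ).Acyclic := by
  have key : ∀ (m : ℕ) (x : fibSub φ m), (∀ a, x.1.1 = a → app φ m a = del B m x.1.2) →
      ∃ y, del (fib φ) m y = x := by
    intro m x hx
    obtain ⟨a, ha⟩ := (hφ (m + 1)).2 x.1.2
    refine ⟨(⟨(a, 0), fun hm => absurd hm (Nat.succ_ne_zero m)⟩ : fibSub φ (m + 1)), ?_⟩
    rw [del_fib]
    refine Subtype.ext (Prod.ext ((hφ m).1 ?_) ?_)
    · change app φ m (del A m a) = app φ m x.1.1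
      rw [hx _ rfl, app_del, ha]
    · change app φ (m + 1) a - del B (m + 1) 0 = x.1.2
      rw [ha, map_zero, sub_zero]
  rw [acyclic_iff]
  refine ⟨fun x => key 0 x fun a ha => ?_, fun m x hx => key (m + 1) x fun a ha => ?_⟩
  · subst ha
    exact x.2 rfl
  · subst ha
    rw [del_fib] at hx
    exact sub_eq_zero.1 (congrArg (fun y : fibSub φ m => y.1.2) hx)

theorem acyclic_fib_of_isZero {φ : A ⟶ B} (hA : ∀ m, Subsingleton (A.X m)) (hB : B.Acyclic) :
    (fib φ).Acyclic := by
  have hB' := ((acyclic_iff B).1 hB).2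
  have key : ∀ (m : ℕ) (x : fibSub φ m), del B m x.1.2 = 0 → ∃ y, del (fib φ) m y = x := by
    intro m x hx
    obtain ⟨b, hb⟩ := hB' m x.1.2 hx
    refine ⟨(⟨(0, -b), fun hm => absurd hm (Nat.succ_ne_zero m)⟩ : fibSub φ (m + 1)), ?_⟩
    rw [del_fib]
    refine Subtype.ext (Prod.ext (Subsingleton.elim _ _) ?_)
    change app φ (m + 1) 0 - del B (m + 1) (-b) = x.1.2
    rw [map_neg, hb, map_zero, zero_sub, neg_neg]
  rw [acyclic_iff]
  refine ⟨fun x => key 0 x ?_, fun m x hx => key (m + 1) x ?_⟩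
  · have h0 : app φ 0 x.1.1 = del B 0 x.1.2 := x.2 rfl
    rw [← h0, Subsingleton.elim x.1.1 0, map_zero]
  · rw [del_fib] at hx
    have h0 : app φ (m + 1) x.1.1 - del B (m + 1) x.1.2 = 0 :=
      congrArg (fun y : fibSub φ m => y.1.2) hx
    rw [Subsingleton.elim x.1.1 0, map_zero, zero_sub, neg_eq_zero] at h0
    exact h0

/-- If `H₀(φ)` is onto, then `A₀ × B₁ → B₀` is a split surjection, so its kernel, the term of degree
zero of the homotopy fibre, is again projective. -/
theorem isPerf_fib {n : ℕ∞} {φ : A ⟶ B} (hA : IsPerf n A) (hB : IsPerf (n + 1) B)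
    (hφ : H0Surj φ) : IsPerf n (fib φ) := by
  obtain ⟨h1, ⟨N, hN⟩, h2⟩ := hA
  obtain ⟨h1', ⟨N', hN'⟩, h2'⟩ := hB
  have hz : ∀ i, IsZero (A.X i) → IsZero (B.X (i + 1)) → IsZero ((fib φ).X i) := by
    intro i h1 h2
    rw [ModuleCat.isZero_iff_subsingleton] at h1 h2 ⊢
    exact inferInstanceAs (Subsingleton (fibSub φ i))
  refine ⟨fun i => ?_, ⟨max N N', fun i hi => hz i (hN i ?_) (hN' (i + 1) ?_)⟩,
    fun i hi => hz i (h2 i hi) (h2' (i + 1) ?_)⟩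
  · have := (h1 i).1
    have := (h1 i).2
    have := (h1' (i + 1)).1
    have := (h1' (i + 1)).2
    have := (h1' i).2
    have hr : ∃ r : A.X i × B.X (i + 1) →ₗ[R] fibSub φ i,
        r ∘ₗ (fibSub φ i).subtype = LinearMap.id := by
      rcases i with _ | i
      · let g : A.X 0 × B.X 1 →ₗ[R] B.X 0 :=
          app φ 0 ∘ₗ LinearMap.fst R _ _ - del B 0 ∘ₗ LinearMap.snd R _ _
        obtain ⟨σ, hσ⟩ := LinearMap.exists_rightInverse_of_surjective g
          (LinearMap.range_eq_top.2 fun y => by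
            obtain ⟨a, b, hab⟩ := hφ y
            refine ⟨(a, -b), ?_⟩
            change app φ 0 a - del B 0 (-b) = y
            rw [map_neg, sub_neg_eq_add, hab])
        refine ⟨LinearMap.codRestrict _ (LinearMap.id - σ ∘ₗ g) fun x _ => ?_, ?_⟩
        · rw [← sub_eq_zero]
          change g (x - σ (g x)) = 0
          rw [map_sub, sub_eq_zero]
          exact (LinearMap.congr_fun hσ (g x)).symm
        · refine LinearMap.ext fun x => Subtype.ext ?_
          have hx : g x.1 = 0 := sub_eq_zero.2 (x.2 rfl)
          change x.1 - σ (g x.1) = x.1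
          rw [hx, map_zero, sub_zero]
      · exact ⟨LinearMap.codRestrict _ LinearMap.id fun x hx => absurd hx (Nat.succ_ne_zero i),
          rfl⟩
    obtain ⟨r, hr⟩ := hr
    exact ⟨Module.Finite.of_surjective r fun x => ⟨x.1, LinearMap.congr_fun hr x⟩,
      Module.Projective.of_split _ r hr⟩
  · omega
  · omega
  · push_cast
    exact (ENat.add_lt_add_iff_right ENat.one_ne_top).2 hi

end ModCx

namespace TMod

open ModCx

variable {R : Type u} [CommRing R] {d : ℕ} {s u : Fin d → R}
  {A B A' B' A'' B'' : TMod s}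

/-- The endomorphism `(a, b) ↦ (e a, -e b)` of degree one of the homotopy fibre. It would be a
homotopy from `s` to zero if `φ` were equivariant. -/
def fibHtpy (φ : A.cx ⟶ B.cx) (i : Fin d) (m : ℕ) :
    fibSub φ m →ₗ[R] fibSub φ (m + 1) :=
  LinearMap.codRestrict _ ((e A i m).prodMap (-e B i (m + 1)) ∘ₗ (fibSub φ m).subtype)
    (fun _ hm => absurd hm (Nat.succ_ne_zero m))

/-- The defect `(a, b) ↦ (0, φ (e a) - e (φ a))` of `fibHtpy`. -/
def fibDefect (φ : A.cx ⟶ B.cx) (i : Fin d) (m : ℕ) :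
    fibSub φ m →ₗ[R] fibSub φ m :=
  LinearMap.codRestrict _ (LinearMap.inr R _ _ ∘ₗ
    (app φ (m + 1) ∘ₗ e A i m - e B i m ∘ₗ app φ m) ∘ₗ LinearMap.fst R _ _ ∘ₗ
      (fibSub φ m).subtype)
    (fun x hm => by
      subst hm
      change app φ 0 0 = del B.cx 0 (app φ 1 (e A i 0 x.1.1) - e B i 0 (app φ 0 x.1.1))
      rw [map_zero, map_sub, ← app_del, (isNullhtpy A i).zero, (isNullhtpy B i).zero, map_smul,
        sub_self])

/-- The homotopy fibre of a chain map between `T_s`-modules that need not be equivariant. It is a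
module over `T_{s²}`. -/
abbrev fib (hu : ∀ i, s i * s i = u i) (φ : A.cx ⟶ B.cx) : TMod u :=
  mk (ModCx.fib φ)
    (fun i => correct (X := ModCx.fib φ) (s i) (fibHtpy φ i) (fibDefect φ i)) (fun i =>
    isNullhtpy_correct (X := ModCx.fib φ) (hu i)
      (fun x => by
        rw [del_fib]
        refine Subtype.ext (Prod.ext ((isNullhtpy A i).zero x.1.1 |>.trans (add_zero _).symm) ?_)
        have h0 : app φ 0 x.1.1 = del B.cx 0 x.1.2 := x.2 rfl
        have h1 := (isNullhtpy B i).succ 0 x.1.2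
        change app φ 1 (e A i 0 x.1.1) - del B.cx 1 (-e B i 1 x.1.2) =
          s i • x.1.2 + (app φ 1 (e A i 0 x.1.1) - e B i 0 (app φ 0 x.1.1))
        rw [map_neg, h0, ← h1]
        abel)
      (fun m x => by
        rw [del_fib, del_fib]
        refine Subtype.ext (Prod.ext
          ((isNullhtpy A i).succ m x.1.1 |>.trans (add_zero _).symm) ?_)
        have h1 := (isNullhtpy B i).succ (m + 1) x.1.2
        change app φ (m + 2) (e A i (m + 1) x.1.1) - del B.cx (m + 2) (-e B i (m + 2) x.1.2) +
          -e B i (m + 1) (app φ (m + 1) x.1.1 - del B.cx (m + 1) x.1.2) =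
          s i • x.1.2 + (app φ (m + 2) (e A i (m + 1) x.1.1) - e B i (m + 1) (app φ (m + 1) x.1.1))
        rw [map_neg, map_sub, ← h1]
        abel)
      (fun m x => by
        refine Subtype.ext (Prod.ext rfl ?_)
        change app φ (m + 1) (e A i m 0) - e B i m (app φ m 0) = 0
        rw [map_zero, map_zero, map_zero, map_zero, sub_zero]))

theorem e_fib (hu : ∀ i, s i * s i = u i) (φ : A.cx ⟶ B.cx) (i : Fin d) (m : ℕ)
    (x : fibSub φ m) : (e (fib hu φ) i m x : fibSub φ (m + 1)).1 =
      (s i • e A i m x.1.1, -(s i • e B i (m + 1) x.1.2) +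
        e B i (m + 1) (app φ (m + 1) (e A i m x.1.1) - e B i m (app φ m x.1.1))) := by
  refine Prod.ext ?_ ?_
  · change s i • e A i m x.1.1 - e A i m 0 = _
    rw [map_zero, sub_zero]
  · change s i • -e B i (m + 1) x.1.2 -
      -e B i (m + 1) (app φ (m + 1) (e A i m x.1.1) - e B i m (app φ m x.1.1)) = _
    rw [smul_neg, sub_neg_eq_add]

theorem isEquivariant_fibMap (hu : ∀ i, s i * s i = u i) {φ' : A'.cx ⟶ B'.cx} {φ : A.cx ⟶ B.cx}
    {α : A'.cx ⟶ A.cx} {β : B'.cx ⟶ B.cx} (hα : IsEquivariant α) (hβ : IsEquivariant β)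
    (h : α ≫ φ = φ' ≫ β) :
    IsEquivariant (X := fib hu φ') (Y := fib hu φ) (fibMap φ' φ α β h) := by
  intro i m x
  have h1 : ∀ m x, app β m (app φ' m x) = app φ m (app α m x) := fun m x =>
    (congrArg (fun f => app f m x) h).symm
  refine Subtype.ext ?_
  rw [e_fib, fibMap_app, fibMap_app, e_fib]
  refine Prod.ext ?_ ?_
  · change app α (m + 1) (s i • e A' i m x.1.1) = s i • e A i m (app α m x.1.1)
    rw [map_smul, hα]
  · dsimp only
    rw [map_add, map_neg, map_smul, hβ, hβ, map_sub, h1, hα, hβ, h1]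

theorem isEquivariant_fibFst (hu : ∀ i, s i * s i = u i) (φ : A.cx ⟶ B.cx) :
    IsEquivariant (X := fib hu φ) (Y := res hu A) (fibFst φ) := by
  intro i m x
  exact congrArg Prod.fst (e_fib hu φ i m x)

end TMod

/-! ### Direct sums of complexes -/

namespace ModCx

variable {R : Type u} [CommRing R] (X Y : ChainComplex (ModuleCat.{u} R) ℕ)

/-- The inclusion of the first summand. -/
def inl : X ⟶ prod X Y :=
  homMk (Y := prod X Y) (fun m => LinearMap.inl R (X.X m) (Y.X m)) fun m x => by
    rw [del_prod]
    exact Prod.ext rfl (map_zero _).symm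

/-- The inclusion of the second summand. -/
def inr : Y ⟶ prod X Y :=
  homMk (Y := prod X Y) (fun m => LinearMap.inr R (X.X m) (Y.X m)) fun m x => by
    rw [del_prod]
    exact Prod.ext (map_zero _).symm rfl

/-- The projection to the first summand. -/
def fst : prod X Y ⟶ X :=
  homMk (X := prod X Y) (fun m => LinearMap.fst R (X.X m) (Y.X m)) fun m x => by
    rw [del_prod]; rfl

/-- The projection to the second summand. -/
def snd : prod X Y ⟶ Y :=
  homMk (X := prod X Y) (fun m => LinearMap.snd R (X.X m) (Y.X m)) fun m x => by
    rw [del_prod]; rfl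

theorem isShortExact_inl_snd : IsShortExact (inl X Y) (snd X Y) where
  inj _ _ _ h := congrArg Prod.fst h
  comp _ _ := rfl
  exact _ x hx := ⟨x.1, Prod.ext rfl (Eq.symm hx)⟩
  surj m y := ⟨((0, y) : X.X m × Y.X m), rfl⟩

theorem isShortExact_inr_fst : IsShortExact (inr X Y) (fst X Y) where
  inj _ _ _ h := congrArg Prod.snd h
  comp _ _ := rfl
  exact _ x hx := ⟨x.2, Prod.ext (Eq.symm hx) rfl⟩
  surj m x := ⟨((x, 0) : X.X m × Y.X m), rfl⟩

variable {X Y} {Z : ChainComplex (ModuleCat.{u} R) ℕ}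

/-- The map `(x, y) ↦ f x + g y`. -/
def desc (f : X ⟶ Z) (g : Y ⟶ Z) : prod X Y ⟶ Z :=
  homMk (X := prod X Y) (fun m => (app f m).coprod (app g m)) fun m x => by
    rw [del_prod, LinearMap.coprod_apply, LinearMap.coprod_apply, app_del, app_del, map_add]

theorem inl_desc (f : X ⟶ Z) (g : Y ⟶ Z) : inl X Y ≫ desc f g = f :=
  hom_ext fun m x => by
    change app f m x + app g m 0 = _
    rw [map_zero, add_zero]

theorem inr_desc (f : X ⟶ Z) (g : Y ⟶ Z) : inr X Y ≫ desc f g = g :=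
  hom_ext fun m x => by
    change app f m 0 + app g m x = _
    rw [map_zero, zero_add]

end ModCx

/-! ### Differences of classes -/

namespace TMod

open ModCx

variable {R : Type u} [CommRing R] {d : ℕ} {s u : Fin d → R} {n : ℕ∞}

theorem isEquivariant_inl (X Y : TMod s) :
    IsEquivariant (X := X) (Y := prod X Y) (inl X.cx Y.cx) := fun i m x => by
  exact Prod.ext rfl (map_zero (e Y i m)).symm

theorem isEquivariant_inr (X Y : TMod s) :
    IsEquivariant (X := Y) (Y := prod X Y) (inr X.cx Y.cx) := fun i m x => by
  exact Prod.ext (map_zero (e X i m)).symm rfl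

theorem isEquivariant_fst (X Y : TMod s) :
    IsEquivariant (X := prod X Y) (Y := X) (fst X.cx Y.cx) := fun i m x => by
  rfl

theorem isEquivariant_snd (X Y : TMod s) :
    IsEquivariant (X := prod X Y) (Y := Y) (snd X.cx Y.cx) := fun i m x => by
  rfl

theorem IsEquivariant.comp {X Y Z : TMod s} {f : X.cx ⟶ Y.cx} {g : Y.cx ⟶ Z.cx}
    (hf : IsEquivariant f) (hg : IsEquivariant g) : IsEquivariant (f ≫ g) := fun i m x =>
  (congrArg (app g (m + 1)) (hf i m x)).trans (hg i m _)

/-- The class of a `T_s`-module in `G(T_s, n)`. -/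
noncomputable abbrev cl (X : TMod s) (hX : IsPerf n X.cx) : GDG (TDGA s) n :=
  GrothGrp.cls (DGModule.forget (TDGA s)) ⟨X.toDG, hX⟩

theorem cl_eq_add {X' X X'' : TMod s} {hX' : IsPerf n X'.cx} {hX : IsPerf n X.cx}
    {hX'' : IsPerf n X''.cx} {f : X'.cx ⟶ X.cx} {g : X.cx ⟶ X''.cx}
    (hf : IsEquivariant f) (hg : IsEquivariant g) (h : IsShortExact f g) :
    cl X hX = cl X' hX' + cl X'' hX'' :=
  GrothGrp.cls_eq_add (U := DGModule.forget (TDGA s)) (hasShortExact hf hg h)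

theorem cl_eq_zero {X : TMod s} {hX : IsPerf n X.cx} (h : X.cx.Acyclic) :
    cl X hX = 0 :=
  GrothGrp.cls_eq_zero (U := DGModule.forget (TDGA s)) h

variable {A A' A'' B : TMod s}

/-- The class of `fib φ` changes by `[A'']` when `φ : A ⟶ B` is restricted to a submodule with
quotient `A''`. -/
theorem cl_fib (hu : ∀ i, s i * s i = u i) {hA : IsPerf n A.cx} {hA' : IsPerf n A'.cx}
    {hA'' : IsPerf n A''.cx} {hB : IsPerf (n + 1) B.cx} {α : A'.cx ⟶ A.cx} {γ : A.cx ⟶ A''.cx}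
    (hα : IsEquivariant α) (hγ : IsEquivariant γ) (h : IsShortExact α γ) {φ : A.cx ⟶ B.cx}
    {φ' : A'.cx ⟶ B.cx} (hφφ' : α ≫ φ = φ') (hφ : H0Surj φ) (hφ' : H0Surj φ') :
    cl (fib hu φ) (isPerf_fib hA hB hφ) =
      cl (fib hu φ') (isPerf_fib hA' hB hφ') + cl (res hu A'') hA'' := by
  subst hφφ'
  exact cl_eq_add (X' := fib hu (α ≫ φ)) (X := fib hu φ) (X'' := res hu A'')
    (isEquivariant_fibMap hu hα (fun _ _ _ => rfl) _)
    (IsEquivariant.comp (X := fib hu φ) (Y := res hu A) (Z := res hu A'')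
      (isEquivariant_fibFst hu φ) (hγ.res hu))
    (isShortExact_fibFst h hφ')

/-- `[A] - [fib φ]`, for a chain map `φ : A ⟶ B` such that `H₀(φ)` is onto. Since `fib φ` is the
homotopy fibre of `φ`, this stands for the class of `B`. It is an element of `G(T_{s²}, n)`,
although `B` may be nonzero in degree `n + 1`. -/
noncomputable def diffCl (hu : ∀ i, s i * s i = u i) (hA : IsPerf n A.cx)
    (hB : IsPerf (n + 1) B.cx) (φ : A.cx ⟶ B.cx) (hφ : H0Surj φ) : GDG (TDGA u) n :=
  cl (res hu A) hA - cl (fib hu φ) (isPerf_fib hA hB hφ)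

/-- The difference `[A] - [fib φ]` depends on `B` alone: for a second choice `ψ : A' ⟶ B`, both
differences agree with the one for `A ⊕ A' ⟶ B`. -/
theorem diffCl_eq (hu : ∀ i, s i * s i = u i) (hA : IsPerf n A.cx) (hA' : IsPerf n A'.cx)
    (hB : IsPerf (n + 1) B.cx) {φ : A.cx ⟶ B.cx} (hφ : H0Surj φ) {ψ : A'.cx ⟶ B.cx}
    (hψ : H0Surj ψ) : diffCl hu hA hB φ hφ = diffCl hu hA' hB ψ hψ := by
  have hd : H0Surj (A := (prod A A').cx) (desc φ ψ) := fun y =>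
    (hφ y).elim fun a ⟨b, hab⟩ => ⟨((a, 0) : A.cx.X 0 × A'.cx.X 0), b, by
      change app φ 0 a + app ψ 0 0 + _ = y
      rw [map_zero, add_zero, hab]⟩
  have h1 := cl_fib hu (hA := isPerf_prod hA hA') (hA' := hA) (hA'' := hA') (hB := hB)
    (isEquivariant_inl A A') (isEquivariant_snd A A') (isShortExact_inl_snd _ _)
    (inl_desc φ ψ) hd hφ
  have h2 := cl_fib hu (hA := isPerf_prod hA hA') (hA' := hA') (hA'' := hA) (hB := hB)
    (isEquivariant_inr A A') (isEquivariant_fst A A') (isShortExact_inr_fst _ _)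
    (inr_desc φ ψ) hd hψ
  rw [diffCl, diffCl, sub_eq_sub_iff_add_eq_add, add_comm, ← h2, add_comm, ← h1]

theorem diffCl_id (hu : ∀ i, s i * s i = u i) (hA : IsPerf n A.cx) (hA' : IsPerf (n + 1) A.cx)
    (h : H0Surj (𝟙 A.cx)) : diffCl hu hA hA' (𝟙 A.cx) h = cl (res hu A) hA := by
  rw [diffCl, cl_eq_zero (X := fib hu (𝟙 A.cx)) (acyclic_fib fun m => Function.bijective_id),
    sub_zero]

/-- If `A` and `B` have the same length, then `[A] = [fib φ] + [B]`. -/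
theorem diffCl_eq_cl (hu : ∀ i, s i * s i = u i) (hA : IsPerf n A.cx) (hB : IsPerf n B.cx)
    (hB' : IsPerf (n + 1) B.cx) {φ : A.cx ⟶ B.cx} (hφ : H0Surj φ) :
    diffCl hu hA hB' φ hφ = cl (res hu B) hB := by
  have h : H0Surj (𝟙 B.cx) := H0Surj.of_surjective fun x => ⟨x, rfl⟩
  rw [diffCl_eq hu hA hB hB' hφ h, diffCl_id]

/-- For acyclic `B` the zero module is an admissible choice of `A`. -/
theorem diffCl_of_acyclic (hu : ∀ i, s i * s i = u i) (hA : IsPerf n A.cx)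
    (hB : IsPerf (n + 1) B.cx) {φ : A.cx ⟶ B.cx} (hφ : H0Surj φ) (h : B.cx.Acyclic) :
    diffCl hu hA hB φ hφ = 0 := by
  have h0 : H0Surj (A := (zero s).cx) (B := B.cx) 0 := H0Surj.of_acyclic _ h
  rw [diffCl_eq hu hA (A' := zero s) (isPerf_zero n) hB hφ h0, diffCl,
    cl_eq_zero (X := fib hu (A := zero s) (B := B) 0)
      (acyclic_fib_of_isZero (fun m => inferInstanceAs (Subsingleton PUnit)) h),
    cl_eq_zero (X := res hu (zero s)) (GrothGrp.acyclic_of_isZero isZero_zero), sub_zero]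

theorem diffCl_add (hu : ∀ i, s i * s i = u i) {B' B'' : TMod s} (hA' : IsPerf n A'.cx)
    (hA : IsPerf n A.cx) (hA'' : IsPerf n A''.cx) (hB' : IsPerf (n + 1) B'.cx)
    (hB : IsPerf (n + 1) B.cx) (hB'' : IsPerf (n + 1) B''.cx) {f : B'.cx ⟶ B.cx}
    {g : B.cx ⟶ B''.cx} (hf : IsEquivariant f) (hg : IsEquivariant g) (h : IsShortExact f g)
    {φ' : A'.cx ⟶ B'.cx} {φ : A.cx ⟶ B.cx} {φ'' : A''.cx ⟶ B''.cx} (hφ' : H0Surj φ')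
    (hφ : H0Surj φ) (hφ'' : H0Surj φ'') :
    diffCl hu hA hB φ hφ = diffCl hu hA' hB' φ' hφ' + diffCl hu hA'' hB'' φ'' hφ'' := by
  -- Independence of the choices allows to replace `φ` by `A' ⊕ A ⟶ B` and `φ''` by `A ⟶ B ⟶ B''`.
  have h1 : H0Surj (A := (prod A' A).cx) (desc (φ' ≫ f) φ) := fun y =>
    (hφ y).elim fun a ⟨b, hab⟩ => ⟨((0, a) : A'.cx.X 0 × A.cx.X 0), b, by
      change app (φ' ≫ f) 0 0 + app φ 0 a + _ = y
      rw [map_zero, zero_add, hab]⟩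
  have h2 : H0Surj (φ ≫ g) := fun y => by
    obtain ⟨z, hz⟩ := h.surj 0 y
    obtain ⟨a, b, hab⟩ := hφ z
    refine ⟨a, app g 1 b, ?_⟩
    change app g 0 (app φ 0 a) + _ = y
    rw [← app_del, ← map_add, hab, hz]
  have hc : inl A'.cx A.cx ≫ desc (φ' ≫ f) φ = φ' ≫ f := inl_desc _ _
  have hc' : snd A'.cx A.cx ≫ φ ≫ g = desc (φ' ≫ f) φ ≫ g := hom_ext fun m x => by
    change app g m (app φ m x.2) = app g m (app f m (app φ' m x.1) + app φ m x.2)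
    rw [map_add, h.comp, zero_add]
  have h3 := cl_eq_add (X' := fib hu φ') (X := fib hu (A := prod A' A) (desc (φ' ≫ f) φ))
    (X'' := fib hu (φ ≫ g)) (hX' := isPerf_fib hA' hB' hφ')
    (hX := isPerf_fib (isPerf_prod hA' hA) hB h1) (hX'' := isPerf_fib hA hB'' h2)
    (isEquivariant_fibMap hu (isEquivariant_inl A' A) hf hc)
    (isEquivariant_fibMap hu (isEquivariant_snd A' A) hg hc')
    (isShortExact_fibMap (isShortExact_inl_snd _ _) h hc hc' hφ')
  have h4 := cl_eq_add (X' := res hu A') (X := res hu (prod A' A)) (X'' := res hu A)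
    (hX' := hA') (hX := isPerf_prod hA' hA) (hX'' := hA)
    ((isEquivariant_inl A' A).res hu) ((isEquivariant_snd A' A).res hu)
    (isShortExact_inl_snd _ _)
  rw [diffCl_eq hu hA (A' := prod A' A) (isPerf_prod hA' hA) hB hφ h1,
    diffCl_eq hu hA'' hA hB'' hφ'' h2, diffCl, diffCl, diffCl, h3, h4]
  abel

end TMod

/-! ### Koszul covers -/

namespace ModCx

variable {R : Type u} [CommRing R]

/-- The complex with `M` in degree zero. -/
abbrev concX (M : ModuleCat.{u} R) : ℕ → ModuleCat.{u} R
  | 0 => M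
  | _ + 1 => ModuleCat.of R PUnit

/-- The complex with `M` in degree zero. -/
abbrev conc (M : ModuleCat.{u} R) : ChainComplex (ModuleCat.{u} R) ℕ :=
  ofDel (concX M) 0 (fun _ _ => rfl)

/-- The inclusion of `X₀`, in degree zero, as a subcomplex of `X`. -/
def concMap (X : ChainComplex (ModuleCat.{u} R) ℕ) : conc (X.X 0) ⟶ X :=
  homMk (X := conc (X.X 0)) (fun m => match m with
    | 0 => LinearMap.id
    | _ + 1 => 0) (fun m x => by
      rw [del_ofDel]
      exact (map_zero _).trans (map_zero _).symm)

theorem isPerf_conc {n : ℕ∞} {X : ChainComplex (ModuleCat.{u} R) ℕ} (hX : IsPerf n X) :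
    IsPerf 0 (conc (X.X 0)) := by
  have h : ∀ i, 0 < i → IsZero ((conc (X.X 0)).X i) := by
    rintro (_ | i) hi
    · exact absurd hi (lt_irrefl 0)
    · exact ModuleCat.isZero_of_subsingleton (ModuleCat.of R PUnit)
  refine ⟨fun i => ?_, ⟨0, h⟩, fun i hi => h i (by exact_mod_cast hi)⟩
  rcases i with _ | i
  · exact hX.1 0
  · exact ⟨inferInstanceAs (Module.Finite R PUnit.{u + 1}),
      inferInstanceAs (Module.Projective R PUnit.{u + 1})⟩

variable (A : ChainComplex (ModuleCat.{u} R) ℕ)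

/-- The terms `A_m ⊕ A_{m-1}` of the tensor product of `A` with a complex `R → R`. -/
abbrev koszulX : ℕ → ModuleCat.{u} R
  | 0 => A.X 0
  | m + 1 => ModuleCat.of R (A.X (m + 1) × A.X m)

/-- The differential `(x, y) ↦ (d x + s y, -d y)`. -/
def koszulDel (s : R) : ∀ m, koszulX A (m + 1) →ₗ[R] koszulX A m
  | 0 => (del A 0).coprod (s • LinearMap.id)
  | m + 1 => ((del A (m + 1)).coprod (s • LinearMap.id)).prod (-del A m ∘ₗ LinearMap.snd R _ _)

/-- The tensor product of `A` with the complex `s : R → R`. -/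
abbrev koszul (s : R) : ChainComplex (ModuleCat.{u} R) ℕ :=
  ofDel (koszulX A) (koszulDel A s) (by
    have h0 : ∀ m (x : A.X (m + 2)) (y : A.X (m + 1)),
        del A m (del A (m + 1) x + s • y) + s • -del A m y = 0 := by
      intro m x y
      rw [map_add, del_del, map_smul, zero_add, smul_neg, add_neg_cancel]
    rintro (_ | m) ⟨x, y⟩
    · exact h0 0 x y
    · refine Prod.ext (h0 (m + 1) x y) ?_
      change -del A m (-del A (m + 1) y) = 0
      rw [map_neg, del_del, neg_zero, neg_zero])

/-- The homotopy `(x, y) ↦ (0, x)` from `s` to zero on `koszul A s`. -/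
def koszulHtpy : ∀ m, koszulX A m →ₗ[R] koszulX A (m + 1)
  | 0 => LinearMap.inr R _ _
  | _ + 1 => LinearMap.inr R _ _ ∘ₗ LinearMap.fst R _ _

theorem isNullhtpy_koszulHtpy (s : R) :
    IsNullhtpy (koszul A s) s (koszulHtpy A) where
  zero x := by
    rw [del_ofDel]
    change del A 0 0 + s • x = s • x
    rw [map_zero, zero_add]
  succ m x := by
    rw [del_ofDel, del_ofDel]
    obtain ⟨x, y⟩ := x
    rcases m with _ | m
    · refine Prod.ext ?_ ?_
      · change del A 1 0 + s • x + 0 = s • x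
        rw [map_zero, zero_add, add_zero]
      · change -del A 0 x + (del A 0 x + s • y) = s • y
        rw [neg_add_cancel_left]
    · refine Prod.ext ?_ ?_
      · change del A (m + 2) 0 + s • x + 0 = s • x
        rw [map_zero, zero_add, add_zero]
      · change -del A (m + 1) x + (del A (m + 1) x + s • y) = s • y
        rw [neg_add_cancel_left]

variable {A} in
/-- The homotopy `(x, y) ↦ (h x, -h y)` on `koszul A s` given by a homotopy `h` on `A`. -/
def koszulExtend (h : ∀ m, A.X m →ₗ[R] A.X (m + 1)) :
    ∀ m, koszulX A m →ₗ[R] koszulX A (m + 1)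
  | 0 => LinearMap.inl R _ _ ∘ₗ h 0
  | m + 1 => (h (m + 1)).prodMap (-h m)

theorem isNullhtpy_koszulExtend (s : R) {t : R} {h : ∀ m, A.X m →ₗ[R] A.X (m + 1)}
    (hh : IsNullhtpy A t h) : IsNullhtpy (koszul A s) t (koszulExtend h) where
  zero x := by
    rw [del_ofDel]
    change del A 0 (h 0 x) + s • 0 = t • x
    rw [hh.zero, smul_zero, add_zero]
  succ m x := by
    rw [del_ofDel, del_ofDel]
    obtain ⟨x, y⟩ := x
    have h1 : ∀ m (x : A.X (m + 1)) (y : A.X m), del A (m + 1) (h (m + 1) x) + s • -h m y +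
        h m (del A m x + s • y) = t • x := by
      intro m x y
      rw [map_add, map_smul, ← hh.succ, smul_neg]
      abel
    rcases m with _ | m
    · refine Prod.ext (h1 0 x y) ?_
      change -del A 0 (-h 0 y) + 0 = t • y
      rw [map_neg, neg_neg, hh.zero, add_zero]
    · refine Prod.ext (h1 (m + 1) x y) ?_
      change -del A (m + 1) (-h (m + 1) y) + -h m (-del A m y) = t • y
      rw [map_neg, map_neg, neg_neg, neg_neg, hh.succ]

variable {A}

/-- A chain map `φ : A ⟶ X` and a homotopy `h` from `s` to zero on `X` give the chain map
`(x, y) ↦ φ x + h (φ y)`. -/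
def koszulDesc {X : ChainComplex (ModuleCat.{u} R) ℕ} {s : R}
    {h : ∀ m, X.X m →ₗ[R] X.X (m + 1)} (hh : IsNullhtpy X s h) (φ : A ⟶ X) : koszul A s ⟶ X :=
  homMk (X := koszul A s) (fun m => match m with
    | 0 => app φ 0
    | m + 1 => (app φ (m + 1)).coprod (h m ∘ₗ app φ m)) (by
      rintro m ⟨x, y⟩
      rw [del_ofDel]
      rcases m with _ | m
      · change app φ 0 (del A 0 x + s • y) = del X 0 (app φ 1 x + h 0 (app φ 0 y))
        rw [map_add, map_add, map_smul, hh.zero, app_del]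
      · change app φ (m + 1) (del A (m + 1) x + s • y) + h m (app φ m (-del A m y)) =
          del X (m + 1) (app φ (m + 2) x + h (m + 1) (app φ (m + 1) y))
        rw [map_add, map_add, map_smul, ← hh.succ, app_del, map_neg, map_neg, app_del]
        abel)

theorem isPerf_koszul {n : ℕ} (s : R) (hA : IsPerf n A) : IsPerf (n + 1 : ℕ) (koszul A s) := by
  obtain ⟨h1, -, h2⟩ := hA
  have h : ∀ i, n + 1 < i → IsZero ((koszul A s).X i) := by
    rintro (_ | i) hi
    · exact absurd hi (Nat.not_lt_zero _)
    · have h3 := h2 (i + 1) (by exact_mod_cast (by omega : n < i + 1))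
      have h4 := h2 i (by exact_mod_cast (by omega : n < i))
      rw [ModuleCat.isZero_iff_subsingleton] at h3 h4 ⊢
      exact inferInstanceAs (Subsingleton (A.X (i + 1) × A.X i))
  refine ⟨fun i => ?_, ⟨n + 1, h⟩, fun i hi => h i (by exact_mod_cast hi)⟩
  rcases i with _ | i
  · exact h1 0
  · have := (h1 i).1
    have := (h1 i).2
    have := (h1 (i + 1)).1
    have := (h1 (i + 1)).2
    exact ⟨inferInstanceAs (Module.Finite R (A.X (i + 1) × A.X i)),
      inferInstanceAs (Module.Projective R (A.X (i + 1) × A.X i))⟩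

end ModCx

namespace TMod

open ModCx

variable {R : Type u} [CommRing R] {d : ℕ} {s : Fin d → R}

/-- The Koszul complex of `s` with coefficients in `X₀`, a `T_s`-module of length `d`, maps onto a
`T_s`-module `X` in degree zero. The map is not equivariant: it sends
`e_{i₁} ∧ ⋯ ∧ e_{iₖ} ⊗ x` to `e_{i₁} ⋯ e_{iₖ} x` for one ordering of the indices. -/
theorem exists_cover {n : ℕ∞} (X : TMod s) (hX : IsPerf n X.cx) :
    ∃ A : TMod s, IsPerf d A.cx ∧ ∃ φ : A.cx ⟶ X.cx, Function.Surjective (app φ 0) := by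
  have key : ∀ I : Finset (Fin d), ∃ (A : ChainComplex (ModuleCat.{u} R) ℕ)
      (h : Fin d → ∀ m, A.X m →ₗ[R] A.X (m + 1)) (φ : A ⟶ X.cx), IsPerf I.card A ∧
        (∀ i ∈ I, IsNullhtpy A (s i) (h i)) ∧ Function.Surjective (app φ 0) := by
    intro I
    induction I using Finset.induction_on with
    | empty =>
      exact ⟨conc (X.cx.X 0), 0, concMap X.cx, isPerf_conc hX,
        fun i hi => absurd hi (Finset.notMem_empty i), fun x => ⟨x, rfl⟩⟩
    | insert k I hk ih =>
      obtain ⟨A, h, φ, h1, h2, h3⟩ := ih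
      refine ⟨koszul A (s k), fun i => if i = k then koszulHtpy A else koszulExtend (h i),
        koszulDesc (X.isNullhtpy k) φ, ?_, fun i hi => ?_, h3⟩
      · rw [Finset.card_insert_of_notMem hk]
        exact isPerf_koszul _ h1
      · by_cases hik : i = k
        · subst hik
          dsimp only
          rw [if_pos rfl]
          exact isNullhtpy_koszulHtpy A (s i)
        · dsimp only
          rw [if_neg hik]
          exact isNullhtpy_koszulExtend A (s k) (h2 i (Finset.mem_of_mem_insert_of_ne hi hik))
  obtain ⟨A, h, φ, h1, h2, h3⟩ := key Finset.univ
  rw [Finset.card_univ, Fintype.card_fin] at h1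
  exact ⟨⟨A, h, fun i => h2 i (Finset.mem_univ i)⟩, h1, φ, h3⟩

end TMod

/-! ### Classes of `T_s`-modules -/

namespace TMod

open ModCx

variable {R : Type u} [CommRing R] {d : ℕ} {s t u : Fin d → R} {n : ℕ∞}

theorem mk_congr {X : ChainComplex (ModuleCat.{u} R) ℕ}
    {e e' : Fin d → ∀ m, X.X m →ₗ[R] X.X (m + 1)} {h : ∀ i, IsNullhtpy X (s i) (e i)}
    {h' : ∀ i, IsNullhtpy X (s i) (e' i)} (he : ∀ i m x, e i m x = e' i m x) :
    mk X e h = mk X e' h' := by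
  obtain rfl : e = e' := funext fun i => funext fun m => LinearMap.ext (he i m)
  rfl

theorem ofDG_toDG (X : TMod s) : ofDG (toDG X) = X :=
  mk_congr (X := X.cx) fun i m x => toDG_act_ι X i m x

/-- An isomorphism of complexes that is compatible with the action of the generators gives an
isomorphism of dg-modules. -/
noncomputable def isoToDG {Y : DGModule (TDGA s)} {X : TMod s} (f : Y.cx ≅ X.cx)
    (hf : ∀ i m x, app f.hom (m + 1) (Y.act m (m + 1) (FreeAlgebra.ι R i) x) =
      X.e i m (app f.hom m x)) : Y ≅ X.toDG :=
  DGModule.isoMk (X := Y) (Y := X.toDG) f (map_act (X := Y) (Y := X.toDG) f.hom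
    fun i m x => (hf i m x).trans (toDG_act_ι X i m _).symm)

theorem cls_eq_cl (X : DGModule (TDGA s)) (hX : IsPerf n X.cx) :
    GrothGrp.cls (DGModule.forget (TDGA s)) (⟨X, hX⟩ : (DGModule.perf _ n).FullSubcategory) =
      cl (ofDG X) hX :=
  GrothGrp.cls_eq_of_iso _ (ObjectProperty.isoMk _
    (isoToDG (Y := X) (X := ofDG X) (Iso.refl X.cx) fun _ _ _ => rfl))

/-- Restriction of scalars does not change the underlying complex. -/
def restrictIso {A B : DGAlgebra R} (f : A.Hom B) (X : DGModule B) :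
    ((DGModule.restrict f).obj X).cx ≅ X.cx :=
  Iso.refl X.cx

theorem restrictIso_act {A B : DGAlgebra R} (f : A.Hom B) (X : DGModule B) (q r : ℕ)
    (a : A.carrier) (x : ((DGModule.restrict f).obj X).cx.X q) :
    app (restrictIso f X).hom r (((DGModule.restrict f).obj X).act q r a x) =
      X.act q r (f.toAlgHom a) (app (restrictIso f X).hom q x) :=
  rfl

theorem res_cls_eq {A B : DGAlgebra R} (f : A.Hom B) {X : DGModule B} (hX : IsPerf n X.cx)
    {Y : DGModule A} (hY : IsPerf n Y.cx) (i : (DGModule.restrict f).obj X ≅ Y) :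
    GDG.res f n (GrothGrp.cls (DGModule.forget B) ⟨X, hX⟩) =
      GrothGrp.cls (DGModule.forget A) ⟨Y, hY⟩ :=
  (GDG.res_cls f n ⟨X, hX⟩).trans (GrothGrp.cls_eq_of_iso _ (ObjectProperty.isoMk _ i))

theorem map_ι (hu : ∀ i, s i * t i = u i) (i : Fin d) :
    (TDGA.map hu).toAlgHom (FreeAlgebra.ι R i) = t i • FreeAlgebra.ι R i := by
  change FreeDGA.scale t (FreeAlgebra.ι R i) = _
  rw [FreeDGA.scale, FreeAlgebra.lift_ι_apply]

/-- The complex underlying `X.toDG` is the one underlying `X`. -/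
def toDGIso (X : TMod s) : X.toDG.cx ≅ X.cx := Iso.refl X.cx

theorem toDGIso_act (X : TMod s) (i : Fin d) (m : ℕ) (x : X.toDG.cx.X m) :
    app (toDGIso X).hom (m + 1) (X.toDG.act m (m + 1) (FreeAlgebra.ι R i) x) =
      X.e i m (app (toDGIso X).hom m x) :=
  toDG_act_ι X i m x

theorem res_cl (hu : ∀ i, s i * t i = u i) (X : TMod s) (hX : IsPerf n X.cx) :
    GDG.res (TDGA.map hu) n (cl X hX) = cl (res hu X) hX := by
  refine res_cls_eq (TDGA.map hu) (X := X.toDG) hX (Y := (res hu X).toDG) hX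
    (isoToDG (Y := (DGModule.restrict (TDGA.map hu)).obj X.toDG) (X := res hu X)
      ((restrictIso (TDGA.map hu) X.toDG).trans (toDGIso X)) fun i m x => ?_)
  have h1 : app (restrictIso (TDGA.map hu) X.toDG).hom (m + 1)
      (((DGModule.restrict (TDGA.map hu)).obj X.toDG).act m (m + 1) (FreeAlgebra.ι R i) x) =
      t i • X.toDG.act m (m + 1) (FreeAlgebra.ι R i)
        (app (restrictIso (TDGA.map hu) X.toDG).hom m x) := by
    refine (restrictIso_act (TDGA.map hu) X.toDG m (m + 1) (FreeAlgebra.ι R i) x).trans ?_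
    rw [map_ι, map_smul, LinearMap.smul_apply]
  refine (congrArg (app (toDGIso X).hom (m + 1)) h1).trans ?_
  rw [map_smul, toDGIso_act]
  rfl

theorem incl_cl {k n : ℕ∞} (h : k ≤ n) (X : TMod s) (hX : IsPerf k X.cx) :
    GDG.incl (TDGA s) h (cl X hX) = cl X (hX.mono h) :=
  GDG.incl_cls h _

theorem hom_ext {G : Type*} [AddCommGroup G] {f g : GDG (TDGA s) n →+ G}
    (h : ∀ (X : TMod s) (hX : IsPerf n X.cx), f (cl X hX) = g (cl X hX)) : f = g :=
  GrothGrp.hom_ext _ _ fun ⟨X, hX⟩ => by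
    rw [cls_eq_cl X hX]
    exact h (ofDG X) hX

theorem exists_of_hasShortExact {X' X X'' : DGModule (TDGA s)}
    (h : GrothGrp.HasShortExact (DGModule.forget (TDGA s)) X' X X'') :
    ∃ (f : (ofDG X').cx ⟶ (ofDG X).cx) (g : (ofDG X).cx ⟶ (ofDG X'').cx),
      IsEquivariant f ∧ IsEquivariant g ∧ IsShortExact f g := by
  obtain ⟨f, g, h, hs⟩ := h
  exact ⟨f.chainMap, g.chainMap, fun i m x => f.map_act _ _ _ x, fun i m x => g.map_act _ _ _ x,
    isShortExact_of_shortExact hs⟩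

/-- The map from a dg-module to the zero module. -/
noncomputable def toZero (X : DGModule (TDGA s)) : X ⟶ (zero s).toDG :=
  ⟨homMk 0 fun _ _ => rfl, fun _ _ _ _ => rfl⟩

/-! ### The homomorphism `W` -/

/-- A chosen Koszul cover. -/
noncomputable def cover {n : ℕ∞} (X : TMod s) (hX : IsPerf n X.cx) : TMod s :=
  (exists_cover X hX).choose

theorem isPerf_cover {k n : ℕ∞} (hk : d ≤ k) (X : TMod s) (hX : IsPerf n X.cx) :
    IsPerf k (cover X hX).cx :=
  (exists_cover X hX).choose_spec.1.mono hk

/-- The map from the Koszul cover. -/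
noncomputable def coverMap {n : ℕ∞} (X : TMod s) (hX : IsPerf n X.cx) : (cover X hX).cx ⟶ X.cx :=
  (exists_cover X hX).choose_spec.2.choose

theorem h0Surj_coverMap {n : ℕ∞} (X : TMod s) (hX : IsPerf n X.cx) : H0Surj (coverMap X hX) :=
  H0Surj.of_surjective (exists_cover X hX).choose_spec.2.choose_spec

/-- The class `[A] - [fib φ]` for the chosen Koszul cover `φ : A ⟶ X`. -/
noncomputable def coverCl (hu : ∀ i, s i * s i = u i) (hn : d ≤ n) (X : TMod s)
    (hX : IsPerf (n + 1) X.cx) : GDG (TDGA u) n :=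
  diffCl hu (isPerf_cover hn X hX) hX (coverMap X hX) (h0Surj_coverMap X hX)

/-- The homomorphism `W : G(T_s, n + 1) → G(T_{s²}, n)`, which sends the class of `X` to
`[A] - [fib φ]` for a Koszul cover `φ : A ⟶ X`. -/
noncomputable def W (hu : ∀ i, s i * s i = u i) (hn : d ≤ n) :
    GDG (TDGA s) (n + 1) →+ GDG (TDGA u) n :=
  GrothGrp.lift (DGModule.forget (TDGA s)) (DGModule.perf (TDGA s) (n + 1))
    (fun X => coverCl hu hn (ofDG X.obj) X.property)
    ⟨(zero s).toDG, isPerf_zero _⟩ isZero_zero toZero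
    (fun X' X X'' h => by
      obtain ⟨f, g, hf, hg, hs⟩ := exists_of_hasShortExact h
      exact diffCl_add hu _ _ _ _ _ _ hf hg hs _ _ _)
    (fun X h => diffCl_of_acyclic hu _ _ _ h)

theorem W_cl (hu : ∀ i, s i * s i = u i) (hn : d ≤ n) {X A : TMod s} (hX : IsPerf (n + 1) X.cx)
    (hA : IsPerf n A.cx) {φ : A.cx ⟶ X.cx} (hφ : H0Surj φ) :
    W hu hn (cl X hX) = diffCl hu hA hX φ hφ := by
  refine (GrothGrp.lift_cls _ _ _ _ _ _ _).trans ?_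
  have key : ∀ (Y : TMod s) (hY : IsPerf (n + 1) Y.cx), Y = X →
      coverCl hu hn Y hY = diffCl hu hA hX φ hφ := by
    rintro Y hY rfl
    exact diffCl_eq hu _ _ _ _ _
  exact key _ _ (ofDG_toDG X)

theorem W_comp_incl (hu : ∀ i, s i * s i = u i) (hn : d ≤ n) :
    (W hu hn).comp (GDG.incl (TDGA s) (le_self_add : n ≤ n + 1)) = GDG.res (TDGA.map hu) n := by
  refine hom_ext fun X hX => ?_
  have h : H0Surj (𝟙 X.cx) := H0Surj.of_surjective fun x => ⟨x, rfl⟩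
  rw [AddMonoidHom.comp_apply, incl_cl, res_cl, W_cl hu hn _ hX h, diffCl_id]

theorem incl_comp_W (hu : ∀ i, s i * s i = u i) (hn : d ≤ n) :
    (GDG.incl (TDGA u) (le_self_add : n ≤ n + 1)).comp (W hu hn) =
      GDG.res (TDGA.map hu) (n + 1) := by
  refine hom_ext fun X hX => ?_
  rw [AddMonoidHom.comp_apply, res_cl, W_cl hu hn _ (isPerf_cover hn X hX) (h0Surj_coverMap X hX),
    diffCl, map_sub, incl_cl, incl_cl]
  exact diffCl_eq_cl hu (isPerf_cover (hn.trans le_self_add) X hX) hX (hX.mono le_self_add)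
    (h0Surj_coverMap X hX)

/-- Naturality of `W` in `s`. -/
theorem W_comp_res {s' u' t' : Fin d → R} (hu : ∀ i, s i * s i = u i)
    (hu' : ∀ i, s' i * s' i = u' i) (ht : ∀ i, s i * t i = s' i) (ht' : ∀ i, u i * t' i = u' i)
    (htt : ∀ i, t i * t i = t' i) (hn : d ≤ n) :
    (W hu' hn).comp (GDG.res (TDGA.map ht) (n + 1)) =
      (GDG.res (TDGA.map ht') n).comp (W hu hn) := by
  refine hom_ext fun X hX => ?_
  have h1 : ∀ A : TMod s, res hu' (res ht A) = res ht' (res hu A) := fun A =>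
    mk_congr fun i m x => by
      change s' i • t i • A.e i m x = t' i • s i • A.e i m x
      rw [smul_smul, smul_smul, ← ht, ← htt]
      ring_nf
  have h2 : ∀ (A B : TMod s) (φ : A.cx ⟶ B.cx), fib hu' (A := res ht A) (B := res ht B) φ =
      res ht' (fib hu φ) := fun A B φ => mk_congr fun i m x => Subtype.ext <| by
    refine (e_fib hu' (A := res ht A) (B := res ht B) φ i m x).trans ?_
    refine Eq.trans ?_ (congrArg (t' i • ·) (e_fib hu φ i m x)).symm
    have h3 : s' i * t i = t' i * s i := by rw [← ht, ← htt]; ring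
    have h4 : ∀ y : A.cx.X (m + 1), app φ (m + 1) (t i • y) = t i • app φ (m + 1) y := fun y =>
      map_smul _ _ _
    refine Prod.ext ?_ ?_
    · change s' i • t i • A.e i m x.1.1 = t' i • s i • A.e i m x.1.1
      rw [smul_smul, smul_smul, h3]
    · change -(s' i • t i • B.e i (m + 1) x.1.2) + t i • B.e i (m + 1)
          (app φ (m + 1) (t i • A.e i m x.1.1) - t i • B.e i m (app φ m x.1.1)) =
        t' i • (-(s i • B.e i (m + 1) x.1.2) + B.e i (m + 1)
          (app φ (m + 1) (A.e i m x.1.1) - B.e i m (app φ m x.1.1)))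
      rw [h4, ← smul_sub, map_smul, smul_smul, smul_smul, smul_add, smul_neg, smul_smul, h3, htt]
  rw [AddMonoidHom.comp_apply, AddMonoidHom.comp_apply, res_cl,
    W_cl hu hn hX (isPerf_cover hn X hX) (h0Surj_coverMap X hX),
    W_cl hu' hn (X := res ht X) (A := res ht (cover X hX)) hX (isPerf_cover hn X hX)
      (φ := coverMap X hX) (h0Surj_coverMap X hX), diffCl, diffCl, map_sub, res_cl, res_cl]
  congr 1
  · congr 1
    exact h1 _
  · congr 1
    exact h2 _ _ _

end TMod

/-! ### Homotopies on complexes that become exact after localization -/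

namespace ModCx

variable {R : Type u} [CommRing R]

theorem exists_del_eq_smul {S : Submonoid R} {X : ChainComplex (ModuleCat.{u} R) ℕ}
    (h : (((ModuleCat.localizedModuleFunctor.{u} S).mapHomologicalComplex _).obj X).Acyclic) :
    (∀ x, ∃ c ∈ S, ∃ y, del X 0 y = c • x) ∧
      ∀ m x, del X m x = 0 → ∃ c ∈ S, ∃ y, del X (m + 1) y = c • x := by
  obtain ⟨h0, h1⟩ := (acyclic_iff _).1 h
  let L : ∀ m, X.X m →ₗ[R] (X.X m).localizedModule S := fun m =>
    (X.X m).localizedModuleMkLinearMap S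
  have key : ∀ m (x : X.X m), (∃ y, IsLocalizedModule.map S (L (m + 1)) (L m) (del X m) y = L m x) →
      ∃ c ∈ S, ∃ y, del X m y = c • x := by
    rintro m x ⟨y, hy⟩
    obtain ⟨⟨z, t⟩, rfl⟩ := IsLocalizedModule.mk'_surjective S (L (m + 1)) y
    have h2 := (IsLocalizedModule.map_mk' S (L (m + 1)) (L m) (del X m) z t).symm.trans hy
    rw [IsLocalizedModule.mk'_eq_iff, Submonoid.smul_def, ← map_smul] at h2
    obtain ⟨c, hc⟩ := (IsLocalizedModule.eq_iff_exists S (L m)).1 h2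
    refine ⟨c * t, mul_mem c.2 t.2, (c : R) • z, ?_⟩
    rw [map_smul, mul_smul]
    exact hc
  refine ⟨fun x => key 0 x (h0 (L 0 x)), fun m x hx => key (m + 1) x (h1 m (L (m + 1) x) ?_)⟩
  refine (IsLocalizedModule.map_apply S (L (m + 1)) (L m) (del X m) x).trans ?_
  rw [hx, map_zero]
  rfl

/-- A map from a finitely generated projective module that factors through `g` up to `S`-torsion
on each element has a multiple that factors through `g`. -/
theorem exists_lift_smul {S : Submonoid R} {M A B : Type u} [AddCommGroup M] [Module R M]
    [AddCommGroup A] [Module R A] [AddCommGroup B] [Module R B] [Module.Finite R M]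
    [Module.Projective R M] (f : M →ₗ[R] B) (g : A →ₗ[R] B)
    (h : ∀ x, ∃ c ∈ S, ∃ y, g y = c • f x) :
    ∃ c ∈ S, ∃ k : M →ₗ[R] A, ∀ x, g (k x) = c • f x := by
  obtain ⟨G, hG⟩ := (Module.Finite.fg_top : (⊤ : Submodule R M).FG)
  choose c hc y hy using h
  have hr : ∀ x, (∏ z ∈ G, c z) • f x ∈ LinearMap.range g := by
    intro x
    have hx : x ∈ Submodule.span R (G : Set M) := hG ▸ Submodule.mem_top
    induction hx using Submodule.span_induction with
    | mem z hz =>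
      classical
      rw [← Finset.prod_erase_mul _ _ hz, mul_smul, ← hy]
      exact Submodule.smul_mem _ _ ⟨_, rfl⟩
    | zero => rw [map_zero, smul_zero]; exact zero_mem _
    | add a b _ _ ha hb => rw [map_add, smul_add]; exact add_mem ha hb
    | smul a b _ hb => rw [map_smul, smul_comm]; exact Submodule.smul_mem _ _ hb
  obtain ⟨k, hk⟩ := Module.projective_lifting_property g.rangeRestrict
    (LinearMap.codRestrict (LinearMap.range g) ((∏ z ∈ G, c z) • f) hr) g.surjective_rangeRestrict
  exact ⟨_, prod_mem fun z _ => hc z, k, fun x =>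
    congrArg Subtype.val (LinearMap.congr_fun hk x)⟩

/-- On a bounded complex of finitely generated projective modules that becomes exact after inverting
`S`, multiplication by some element of `S` is null-homotopic. -/
theorem exists_isNullhtpy {S : Submonoid R} {n : ℕ∞} {X : ChainComplex (ModuleCat.{u} R) ℕ}
    (hX : IsPerf n X)
    (h : (((ModuleCat.localizedModuleFunctor.{u} S).mapHomologicalComplex _).obj X).Acyclic) :
    ∃ s ∈ S, ∃ k, IsNullhtpy X s k := by
  obtain ⟨h0, h1⟩ := exists_del_eq_smul h
  obtain ⟨hp, ⟨N, hN⟩, -⟩ := hX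
  have key : ∀ N, ∃ s ∈ S, ∃ k : ∀ m, X.X m →ₗ[R] X.X (m + 1), (∀ x, del X 0 (k 0 x) = s • x) ∧
      ∀ m < N, ∀ x, del X (m + 1) (k (m + 1) x) + k m (del X m x) = s • x := by
    intro N
    induction N with
    | zero =>
      have := (hp 0).1
      have := (hp 0).2
      obtain ⟨c, hc, k, hk⟩ := exists_lift_smul (S := S) LinearMap.id (del X 0) h0
      refine ⟨c, hc, Function.update 0 0 k, fun x => ?_, fun m hm => absurd hm (Nat.not_lt_zero m)⟩
      rw [Function.update_self]
      exact hk x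
    | succ N ih =>
      obtain ⟨s, hs, k, hk0, hk⟩ := ih
      have := (hp (N + 1)).1
      have := (hp (N + 1)).2
      have hd : ∀ x, del X N (k N (del X N x)) = s • del X N x := by
        intro x
        rcases N with _ | N
        · exact hk0 _
        · rw [← hk N (Nat.lt_succ_self N), del_del, map_zero, add_zero]
      obtain ⟨c, hc, k', hk'⟩ := exists_lift_smul (S := S) (s • LinearMap.id - k N ∘ₗ del X N)
        (del X (N + 1)) (fun x => h1 N _ (by
          change del X N (s • x - k N (del X N x)) = 0
          rw [map_sub, map_smul, hd, sub_self]))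
      refine ⟨c * s, mul_mem hc hs, Function.update (fun m => c • k m) (N + 1) k', fun x => ?_,
        fun m hm x => ?_⟩
      · rw [Function.update_of_ne (Nat.succ_ne_zero N).symm, LinearMap.smul_apply, map_smul, hk0,
          mul_smul]
      · rw [Function.update_of_ne (by omega : m ≠ N + 1)]
        rcases Nat.lt_succ_iff_lt_or_eq.1 hm with hm' | rfl
        · rw [Function.update_of_ne (by omega : m + 1 ≠ N + 1), LinearMap.smul_apply,
            LinearMap.smul_apply, map_smul, ← smul_add, hk m hm', mul_smul]
        · rw [Function.update_self, hk']
          change c • (s • x - k m (del X m x)) + c • k m (del X m x) = _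
          rw [← smul_add, sub_add_cancel, mul_smul]
  obtain ⟨s, hs, k, hk0, hk⟩ := key N
  refine ⟨s, hs, k, hk0, fun m x => ?_⟩
  by_cases hm : m < N
  · exact hk m hm x
  · have := ModuleCat.isZero_iff_subsingleton.1 (hN (m + 1) (by omega))
    exact Subsingleton.elim _ _

/-! ### Homotopies on extensions -/

theorem IsShortExact.exists_splitting {A X C : ChainComplex (ModuleCat.{u} R) ℕ} {f : A ⟶ X}
    {g : X ⟶ C} (h : IsShortExact f g) (m : ℕ) [Module.Projective R (C.X m)] :
    ∃ (r : X.X m →ₗ[R] A.X m) (σ : C.X m →ₗ[R] X.X m), (∀ c, app g m (σ c) = c) ∧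
      (∀ a, r (app f m a) = a) ∧ ∀ x, app f m (r x) + σ (app g m x) = x := by
  obtain ⟨σ, hσ⟩ := LinearMap.exists_rightInverse_of_surjective (app g m)
    (LinearMap.range_eq_top.2 (h.surj m))
  have hσ' : ∀ c, app g m (σ c) = c := LinearMap.congr_fun hσ
  let r : X.X m →ₗ[R] A.X m := (LinearEquiv.ofInjective (app f m) (h.inj m)).symm.toLinearMap ∘ₗ
    LinearMap.codRestrict (LinearMap.range (app f m)) (LinearMap.id - σ ∘ₗ app g m) fun x =>
      h.exact m _ (by
        change app g m (x - σ (app g m x)) = 0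
        rw [map_sub, hσ', sub_self])
  have hr : ∀ x, app f m (r x) = x - σ (app g m x) := fun x =>
    congrArg Subtype.val ((LinearEquiv.ofInjective (app f m) (h.inj m)).apply_symm_apply
      (LinearMap.codRestrict (LinearMap.range (app f m)) (LinearMap.id - σ ∘ₗ app g m) _ x))
  refine ⟨r, σ, hσ', fun a => h.inj m ?_, fun x => ?_⟩
  · rw [hr, h.comp, map_zero, sub_zero]
  · rw [hr, sub_add_cancel]

/-- If `s` is null-homotopic on the ends of a short exact sequence that splits in each degree, then
`s²` is null-homotopic on the middle term, compatibly with `s` times the given homotopies. -/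
theorem IsShortExact.exists_isNullhtpy {A X C : ChainComplex (ModuleCat.{u} R) ℕ} {f : A ⟶ X}
    {g : X ⟶ C} (h : IsShortExact f g) (hC : ∀ m, Module.Projective R (C.X m)) {s u : R}
    (hu : s * s = u) {k : ∀ m, A.X m →ₗ[R] A.X (m + 1)} (hk : IsNullhtpy A s k)
    {l : ∀ m, C.X m →ₗ[R] C.X (m + 1)} (hl : IsNullhtpy C s l) :
    ∃ e, IsNullhtpy X u e ∧ (∀ m a, app f (m + 1) (s • k m a) = e m (app f m a)) ∧
      ∀ m x, app g (m + 1) (e m x) = s • l m (app g m x) := by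
  choose r σ hσ hr hrσ using fun m => h.exists_splitting m
  let e₀ : ∀ m, X.X m →ₗ[R] X.X (m + 1) := fun m =>
    app f (m + 1) ∘ₗ k m ∘ₗ r m + σ (m + 1) ∘ₗ l m ∘ₗ app g m
  have hf : ∀ m a, e₀ m (app f m a) = app f (m + 1) (k m a) := fun m a => by
    change app f (m + 1) (k m (r m (app f m a))) + σ (m + 1) (l m (app g m (app f m a))) = _
    rw [hr, h.comp, map_zero, map_zero, add_zero]
  have hg : ∀ m x, app g (m + 1) (e₀ m x) = l m (app g m x) := fun m x => by
    change app g (m + 1) (app f (m + 1) _ + σ (m + 1) (l m (app g m x))) = _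
    rw [map_add, h.comp, hσ, zero_add]
  let E : ∀ m, X.X m →ₗ[R] X.X m := fun m => match m with
    | 0 => del X 0 ∘ₗ e₀ 0 - s • LinearMap.id
    | m + 1 => del X (m + 1) ∘ₗ e₀ (m + 1) + e₀ m ∘ₗ del X m - s • LinearMap.id
  have hEf : ∀ m a, E m (app f m a) = 0 := by
    rintro (_ | m) a
    · change del X 0 (e₀ 0 (app f 0 a)) - s • app f 0 a = 0
      rw [hf, ← app_del, hk.zero, map_smul, sub_self]
    · change del X (m + 1) (e₀ (m + 1) (app f (m + 1) a)) + e₀ m (del X m (app f (m + 1) a)) -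
        s • app f (m + 1) a = 0
      rw [hf, ← app_del, ← app_del, hf, ← map_add, hk.succ, map_smul, sub_self]
  have hgE : ∀ m x, app g m (E m x) = 0 := by
    rintro (_ | m) x
    · change app g 0 (del X 0 (e₀ 0 x) - s • x) = 0
      rw [map_sub, app_del, hg, hl.zero, map_smul, sub_self]
    · change app g (m + 1) (del X (m + 1) (e₀ (m + 1) x) + e₀ m (del X m x) - s • x) = 0
      rw [map_sub, map_add, app_del, hg, hg, app_del, hl.succ, map_smul, sub_self]
  have hEE : ∀ m x, E m (E m x) = 0 := fun m x => by
    obtain ⟨a, ha⟩ := h.exact m _ (hgE m x)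
    rw [← ha, hEf]
  refine ⟨correct s e₀ E, isNullhtpy_correct hu (fun x => ?_) (fun m x => ?_) hEE,
    fun m a => ?_, fun m x => ?_⟩
  · exact (add_sub_cancel (s • x) _).symm
  · exact (add_sub_cancel (s • x) _).symm
  · change _ = s • e₀ m (app f m a) - e₀ m (E m (app f m a))
    rw [hEf, map_zero, sub_zero, hf, map_smul]
  · change app g (m + 1) (s • e₀ m x - e₀ m (E m x)) = _
    rw [map_sub, map_smul, hg, hg, hgE, map_zero, sub_zero]

end ModCx

/-! ### The colimit of the groups `G(T_s, n)` -/

namespace TMod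

open ModCx

variable {R : Type u} [CommRing R] {d : ℕ} {S : Fin d → Submonoid R} {n : ℕ∞}

theorem cl_res_eq_of_bijective {s u : Fin d → R} (hu : ∀ i, s i * s i = u i) {A B : TMod s}
    (hA : IsPerf n A.cx) (hB : IsPerf n B.cx) (φ : A.cx ⟶ B.cx)
    (hφ : ∀ m, Function.Bijective (app φ m)) : cl (res hu A) hA = cl (res hu B) hB := by
  rw [← diffCl_eq_cl hu hA hB (hB.mono le_self_add) (H0Surj.of_surjective (hφ 0).2), diffCl,
    cl_eq_zero (X := fib hu φ) (acyclic_fib hφ), sub_zero]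

/-- Every complex in the definition of `K(R on S, n)` carries the structure of a `T_s`-module for
some `s ∈ S₁ × ⋯ × S_d`. -/
theorem exists_structure {X : ChainComplex (ModuleCat.{u} R) ℕ} (hX : onProp S n X) :
    ∃ (s : TransProd S) (e : Fin d → ∀ m, X.X m →ₗ[R] X.X (m + 1)),
      ∀ i, IsNullhtpy X (s.val i) (e i) := by
  choose s hs e he using fun i => exists_isNullhtpy hX.1 (hX.2 i)
  exact ⟨fun i => ⟨⟨s i, hs i⟩⟩, e, he⟩

/-- The canonical map from `G(T_s, n)` to the colimit. -/
noncomputable abbrev toColim (s : TransProd S) (n : ℕ∞) :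
    GDG (TDGA s.val) n →+ (colimit (colimDiagram S n) : AddCommGrpCat.{u + 1}) :=
  (colimit.ι (colimDiagram S n) s).hom

theorem toColim_res {s t : TransProd S} {x : Fin d → R} (hx : ∀ i, x i ∈ S i)
    (h : ∀ i, s.val i * x i = t.val i) (y : GDG (TDGA s.val) n) :
    toColim t n (GDG.res (TDGA.map h) n y) = toColim s n y := by
  let f : s ⟶ t := fun i => ⟨⟨x i, hx i⟩, Subtype.ext (h i)⟩
  exact congrArg (fun g : (colimDiagram S n).obj s ⟶ colimit (colimDiagram S n) => g.hom y)
    (colimit.w (colimDiagram S n) f)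

theorem toColim_cl_res {s t : TransProd S} {x : Fin d → R} (hx : ∀ i, x i ∈ S i)
    (h : ∀ i, s.val i * x i = t.val i) (X : TMod s.val) (hX : IsPerf n X.cx) :
    toColim t n (cl (res h X) hX) = toColim s n (cl X hX) := by
  rw [← res_cl, toColim_res hx]

/-- The componentwise product in `tS₁ × ⋯ × tS_d`. -/
def mulTrans (s t : TransProd S) : TransProd S := fun i => ⟨(s i).elt * (t i).elt⟩

theorem val_mulTrans (s t : TransProd S) (i : Fin d) :
    s.val i * t.val i = (mulTrans s t).val i := rfl

theorem val_mulTrans' (s t : TransProd S) (i : Fin d) :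
    t.val i * s.val i = (mulTrans s t).val i := mul_comm _ _

theorem val_mem (s : TransProd S) (i : Fin d) : s.val i ∈ S i := (s i).elt.2

/-- The class in the colimit does not depend on the module structure: after restricting to a common
`s`, the identity is a chain map between the two `T_s`-modules, so their classes in `G(T_{s²}, n)`
agree. -/
theorem toColim_cl_eq {s t : TransProd S} {X : TMod s.val} {Y : TMod t.val}
    (hX : IsPerf n X.cx) (hY : IsPerf n Y.cx) (φ : X.cx ⟶ Y.cx)
    (hφ : ∀ m, Function.Bijective (app φ m)) : toColim s n (cl X hX) = toColim t n (cl Y hY) := by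
  let w := mulTrans s t
  have h1 := toColim_cl_res (t := w) (val_mem t) (val_mulTrans s t) X hX
  have h2 := toColim_cl_res (t := w) (val_mem s) (val_mulTrans' s t) Y hY
  have h3 := toColim_cl_res (t := mulTrans w w) (val_mem w) (val_mulTrans w w)
    (res (val_mulTrans s t) X) hX
  have h4 := toColim_cl_res (t := mulTrans w w) (val_mem w) (val_mulTrans w w)
    (res (val_mulTrans' s t) Y) hY
  rw [← h1, ← h2, ← h3, ← h4]
  exact congrArg _ (cl_res_eq_of_bijective (val_mulTrans w w) (A := res (val_mulTrans s t) X)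
    (B := res (val_mulTrans' s t) Y) hX hY φ hφ)

/-- The class in the colimit of a complex, for a chosen structure of `T_s`-module. -/
noncomputable def colimCl (X : ChainComplex (ModuleCat.{u} R) ℕ) (hX : onProp S n X) :
    (colimit (colimDiagram S n) : AddCommGrpCat.{u + 1}) :=
  toColim (exists_structure hX).choose n
    (cl (mk X (exists_structure hX).choose_spec.choose
      (exists_structure hX).choose_spec.choose_spec) hX.1)

theorem toColim_cl {s : TransProd S} (X : TMod s.val) (hX : IsPerf n X.cx)
    (hX' : onProp S n X.cx) : toColim s n (cl X hX) = colimCl X.cx hX' :=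
  toColim_cl_eq (t := (exists_structure hX').choose)
    (Y := mk X.cx (exists_structure hX').choose_spec.choose
      (exists_structure hX').choose_spec.choose_spec) hX hX'.1 (𝟙 X.cx)
    fun _ => Function.bijective_id

/-- Structures on the outer terms over a common `T_w` extend to one on the middle term over
`T_{w²}`. -/
theorem colimCl_add {X' X X'' : ChainComplex (ModuleCat.{u} R) ℕ} (hX' : onProp S n X')
    (hX : onProp S n X) (hX'' : onProp S n X'') {f : X' ⟶ X} {g : X ⟶ X''}
    (h : IsShortExact f g) : colimCl X hX = colimCl X' hX' + colimCl X'' hX'' := by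
  obtain ⟨s, e', he'⟩ := exists_structure hX'
  obtain ⟨t, e'', he''⟩ := exists_structure hX''
  let w := mulTrans s t
  let A : TMod w.val := res (val_mulTrans s t) (mk X' e' he')
  let C : TMod w.val := res (val_mulTrans' s t) (mk X'' e'' he'')
  choose e he hf hg using fun i => h.exists_isNullhtpy (fun m => (hX''.1.1 m).2)
    (val_mulTrans w w i) (A.isNullhtpy i) (C.isNullhtpy i)
  have h1 := cl_eq_add (X' := res (val_mulTrans w w) A) (X := mk X e he)
    (X'' := res (val_mulTrans w w) C) (hX' := hX'.1) (hX := hX.1) (hX'' := hX''.1)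
    (f := f) (g := g) hf hg h
  have h2 := toColim_cl (mk X e he) hX.1 hX
  have h3 := toColim_cl (res (val_mulTrans w w) A) hX'.1 hX'
  have h4 := toColim_cl (res (val_mulTrans w w) C) hX''.1 hX''
  rw [h1, map_add, h3, h4] at h2
  exact h2.symm

theorem colimCl_of_acyclic {X : ChainComplex (ModuleCat.{u} R) ℕ} (hX : onProp S n X)
    (h : X.Acyclic) : colimCl X hX = 0 := by
  rw [colimCl, cl_eq_zero (X := mk X _ _) h, map_zero]

theorem onProp_of_TMod {s : TransProd S} (X : TMod s.val) (hX : IsPerf n X.cx) :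
    onProp S n X.cx :=
  ⟨hX, isSExact_of_TDGA (val_mem s) X.toDG⟩

variable (S n) in
theorem onProp_zero : onProp S n (ModCx.zero (R := R)) :=
  onProp_of_TMod (s := fun _ => ⟨1⟩) (zero _) (isPerf_zero n)

theorem exists_of_hasShortExact_id {X' X X'' : ChainComplex (ModuleCat.{u} R) ℕ}
    (h : GrothGrp.HasShortExact (𝟭 (ChainComplex (ModuleCat.{u} R) ℕ)) X' X X'') :
    ∃ (f : X' ⟶ X) (g : X ⟶ X''), IsShortExact f g :=
  let ⟨f, g, _, h⟩ := h
  ⟨f, g, isShortExact_of_shortExact h⟩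

variable (S n) in
/-- The map from `K(R on S, n)` to the colimit. -/
noncomputable def colimInv :
    KOn S n →+ (colimit (colimDiagram S n) : AddCommGrpCat.{u + 1}) :=
  GrothGrp.lift (𝟭 _) (onProp S n) (fun X => colimCl X.obj X.property)
    ⟨ModCx.zero, onProp_zero S n⟩ isZero_zero (fun _ => 0)
    (fun X' X X'' h => by
      obtain ⟨f, g, h⟩ := exists_of_hasShortExact_id h
      exact colimCl_add _ _ _ h)
    (fun X h => colimCl_of_acyclic X.property h)

theorem colimInv_cls (X : (onProp S n).FullSubcategory) :
    colimInv S n (GrothGrp.cls (𝟭 _) X) = colimCl X.obj X.property :=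
  GrothGrp.lift_cls _ _ _ _ _ _ X

theorem toKOn_cl {s : Fin d → R} (hs : ∀ i, s i ∈ S i) (X : TMod s) (hX : IsPerf n X.cx)
    (hX' : onProp S n X.cx) :
    GDG.toKOn hs n (cl X hX) = GrothGrp.cls (𝟭 _) (⟨X.cx, hX'⟩ : (onProp S n).FullSubcategory) :=
  GDG.toKOn_cls hs n ⟨X.toDG, hX⟩

theorem colimToKOn_toColim (s : TransProd S) (y : GDG (TDGA s.val) n) :
    (colimToKOn S n).hom (toColim s n y) = GDG.toKOn (val_mem s) n y :=
  congrArg (fun g : (colimDiagram S n).obj s ⟶ AddCommGrpCat.of (KOn S n) => g.hom y)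
    (colimit.ι_desc (colimCocone S n) s)

theorem colimInv_toKOn (s : TransProd S) (y : GDG (TDGA s.val) n) :
    colimInv S n (GDG.toKOn (val_mem s) n y) = toColim s n y := by
  have h : (colimInv S n).comp (GDG.toKOn (val_mem s) n) = toColim s n := by
    refine hom_ext fun X hX => ?_
    have hX' := onProp_of_TMod X hX
    rw [AddMonoidHom.comp_apply, toKOn_cl _ X hX hX', colimInv_cls, toColim_cl X hX hX']
  exact DFunLike.congr_fun h y

theorem colimToKOn_colimInv (x : KOn S n) :
    (colimToKOn S n).hom (colimInv S n x) = x := by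
  have h : (colimToKOn S n).hom.comp (colimInv S n) = AddMonoidHom.id _ := by
    refine GrothGrp.hom_ext _ _ fun X => ?_
    rw [AddMonoidHom.comp_apply, colimInv_cls, colimCl]
    refine (colimToKOn_toColim _ _).trans ?_
    exact toKOn_cl _ (mk X.obj _ _) X.property.1 X.property
  exact DFunLike.congr_fun h x

variable (S n) in
theorem isIso_colimToKOn : IsIso (colimToKOn S n) := by
  refine ⟨AddCommGrpCat.ofHom (colimInv S n), colimit.hom_ext fun s => ?_, ?_⟩
  · exact AddCommGrpCat.hom_ext (AddMonoidHom.ext fun y =>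
      (congrArg (colimInv S n) (colimToKOn_toColim s y)).trans (colimInv_toKOn s y))
  · exact AddCommGrpCat.hom_ext (AddMonoidHom.ext colimToKOn_colimInv)

end TMod

/-! ### Comparison of the groups `K(R on S, n)` -/

namespace KOn

open TMod

variable {R : Type u} [CommRing R] {d : ℕ} (S : Fin d → Submonoid R) {n : ℕ∞}

variable {S} in
/-- The group `K(R on S, n)` is generated by the images of the groups `G(T_s, n)`. -/
theorem hom_ext {G : Type*} [AddCommGroup G] {f g : KOn S n →+ G}
    (h : ∀ (s : TransProd S) (y : GDG (TDGA s.val) n),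
      f (GDG.toKOn (val_mem s) n y) = g (GDG.toKOn (val_mem s) n y)) : f = g := by
  refine GrothGrp.hom_ext _ _ fun X => ?_
  obtain ⟨s, e, he⟩ := exists_structure X.property
  have h1 := h s (cl (mk X.obj e he) X.property.1)
  rwa [toKOn_cl (val_mem s) (mk X.obj e he) X.property.1 X.property] at h1

theorem incl_cls {k n : ℕ∞} (h : k ≤ n) (X : (onProp S k).FullSubcategory) :
    incl S h (GrothGrp.cls (𝟭 _) X) = GrothGrp.cls (𝟭 _)
      (⟨X.obj, X.property.1.mono h, X.property.2⟩ : (onProp S n).FullSubcategory) :=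
  GrothGrp.map_cls _ _ _ _ _ _ _ X

theorem incl_incl {k m n : ℕ∞} (h : k ≤ m) (h' : m ≤ n) (x : KOn S k) :
    incl S h' (incl S h x) = incl S (h.trans h') x := by
  have : (incl S h').comp (incl S h) = incl S (h.trans h') :=
    GrothGrp.hom_ext _ _ fun X => by
      rw [AddMonoidHom.comp_apply, incl_cls, incl_cls, incl_cls]
  exact DFunLike.congr_fun this x

theorem incl_refl (x : KOn S n) : incl S (le_refl n) x = x := by
  have : incl S (le_refl n) = AddMonoidHom.id _ :=
    GrothGrp.hom_ext _ _ fun X => by rw [incl_cls]; rfl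
  exact DFunLike.congr_fun this x

variable {S} in
theorem incl_toKOn {k n : ℕ∞} (h : k ≤ n) (s : TransProd S) (y : GDG (TDGA s.val) k) :
    incl S h (GDG.toKOn (val_mem s) k y) = GDG.toKOn (val_mem s) n (GDG.incl _ h y) := by
  have : (incl S h).comp (GDG.toKOn (val_mem s) k) =
      (GDG.toKOn (val_mem s) n).comp (GDG.incl _ h) := by
    refine TMod.hom_ext fun X hX => ?_
    rw [AddMonoidHom.comp_apply, AddMonoidHom.comp_apply, incl_cl,
      toKOn_cl _ X hX (onProp_of_TMod X hX),
      toKOn_cl _ X (hX.mono h) (onProp_of_TMod X (hX.mono h)), incl_cls]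
  exact DFunLike.congr_fun this y

variable {S} in
theorem toKOn_res {s t : TransProd S} {x : Fin d → R} (hx : ∀ i, s.val i * x i = t.val i)
    (y : GDG (TDGA s.val) n) :
    GDG.toKOn (val_mem t) n (GDG.res (TDGA.map hx) n y) = GDG.toKOn (val_mem s) n y :=
  DFunLike.congr_fun (GDG.toKOn_res (TDGA.map hx) (val_mem s) (val_mem t) n) y

/-- The maps `W : G(T_s, n + 1) → G(T_{s²}, n)`, followed by the maps to `K(R on S, n)`. -/
noncomputable def shortenCocone (hn : d ≤ n) : Cocone (colimDiagram S (n + 1)) where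
  pt := AddCommGrpCat.of (KOn S n)
  ι :=
    { app := fun s => AddCommGrpCat.ofHom
        ((GDG.toKOn (val_mem (mulTrans s s)) n).comp (W (val_mulTrans s s) hn))
      naturality := fun s t f => by
        refine AddCommGrpCat.hom_ext (AddMonoidHom.ext fun y => ?_)
        have hf : ∀ i, (mulTrans s s).val i * (((f i).1 : R) * ((f i).1 : R)) =
            (mulTrans t t).val i := fun i => by
          rw [← val_mulTrans, ← val_mulTrans, ← TransProd.mul_eq f i]
          ring
        have h1 := DFunLike.congr_fun (W_comp_res (val_mulTrans s s) (val_mulTrans t t)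
          (TransProd.mul_eq f) hf (fun i => rfl) hn) y
        exact (congrArg (GDG.toKOn (val_mem (mulTrans t t)) n) h1).trans (toKOn_res hf _) }

/-- The homomorphism `K(R on S, n + 1) → K(R on S, n)` given by the homomorphisms `W`. -/
noncomputable def shorten (hn : d ≤ n) : KOn S (n + 1) →+ KOn S n :=
  (colimit.desc (colimDiagram S (n + 1)) (shortenCocone S hn)).hom.comp (colimInv S (n + 1))

variable {S} in
theorem shorten_toKOn (hn : d ≤ n) (s : TransProd S) (y : GDG (TDGA s.val) (n + 1)) :
    shorten S hn (GDG.toKOn (val_mem s) (n + 1) y) =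
      GDG.toKOn (val_mem (mulTrans s s)) n (W (val_mulTrans s s) hn y) := by
  refine (congrArg (colimit.desc (colimDiagram S (n + 1)) (shortenCocone S hn)).hom
    (colimInv_toKOn s y)).trans ?_
  exact congrArg (fun g : (colimDiagram S (n + 1)).obj s ⟶ (shortenCocone S hn).pt => g.hom y)
    (colimit.ι_desc (shortenCocone S hn) s)

/-- On the image of `G(T_s, n)` this is `W i = j`. -/
theorem shorten_incl (hn : d ≤ n) :
    (shorten S hn).comp (incl S (le_self_add : n ≤ n + 1)) = AddMonoidHom.id _ := by
  refine hom_ext fun s y => ?_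
  have h1 := DFunLike.congr_fun (W_comp_incl (val_mulTrans s s) hn) y
  rw [AddMonoidHom.comp_apply] at h1
  rw [AddMonoidHom.comp_apply, incl_toKOn, shorten_toKOn, h1, toKOn_res]
  rfl

/-- On the image of `G(T_s, n + 1)` this is `i W = j`. -/
theorem incl_shorten (hn : d ≤ n) :
    (incl S (le_self_add : n ≤ n + 1)).comp (shorten S hn) = AddMonoidHom.id _ := by
  refine hom_ext fun s y => ?_
  have h1 := DFunLike.congr_fun (incl_comp_W (val_mulTrans s s) hn) y
  rw [AddMonoidHom.comp_apply] at h1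
  rw [AddMonoidHom.comp_apply, shorten_toKOn, incl_toKOn, h1, toKOn_res]
  rfl

theorem bijective_incl_succ (hn : d ≤ n) :
    Function.Bijective (incl S (le_self_add : n ≤ n + 1)) :=
  Function.bijective_iff_has_inverse.2 ⟨shorten S hn, DFunLike.congr_fun (shorten_incl S hn),
    DFunLike.congr_fun (incl_shorten S hn)⟩

theorem bijective_incl_nat {k n : ℕ} (hd : d ≤ k) (h : (k : ℕ∞) ≤ n) :
    Function.Bijective (incl S h) := by
  obtain ⟨j, rfl⟩ := Nat.exists_eq_add_of_le (by exact_mod_cast h : k ≤ n)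
  induction j with
  | zero =>
    have : ⇑(incl S h) = id := funext (incl_refl S)
    rw [this]
    exact Function.bijective_id
  | succ j ih =>
    have h1 : (k : ℕ∞) ≤ (k + j : ℕ) := by exact_mod_cast Nat.le_add_right k j
    have h2 := bijective_incl_succ S (n := (k + j : ℕ))
      (by exact_mod_cast hd.trans (Nat.le_add_right k j))
    have key : ∀ (n : ℕ∞) (hn : (k + j : ℕ) + 1 = n) (h : (k : ℕ∞) ≤ n),
        Function.Bijective (incl S h) := by
      rintro _ rfl h
      have h3 : ⇑(incl S h) = incl S le_self_add ∘ incl S h1 :=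
        funext fun x => (incl_incl S h1 le_self_add x).symm
      rw [h3]
      exact h2.comp (ih h1)
    exact key _ (by push_cast; ring) h

theorem exists_isPerf_nat {X : ChainComplex (ModuleCat.{u} R) ℕ} (hX : IsPerf ⊤ X) :
    
    ∃ N₀ : ℕ, ∀ N : ℕ, N₀ ≤ N → IsPerf N X :=
  hX.2.1.imp fun N₀ hN₀ N hN => ⟨hX.1, hX.2.1, fun i hi =>
    hN₀ i (lt_of_le_of_lt hN (by exact_mod_cast hi))⟩

/-- Since the complexes in `K(R on S, ∞)` are bounded, their classes come from `K(R on S, N)` for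
some finite `N`, and hence from `K(R on S, k)`. -/
theorem exists_incl_eq_cls {k : ℕ} (hd : d ≤ k) (X : (onProp S ⊤).FullSubcategory) :
    ∃ y : KOn S k, ∀ (N : ℕ) (hN : (k : ℕ∞) ≤ N) (hX : IsPerf N X.obj),
      incl S hN y =
        GrothGrp.cls (𝟭 _) (⟨X.obj, hX, X.property.2⟩ : (onProp S N).FullSubcategory) := by
  obtain ⟨N₀, hN₀⟩ := exists_isPerf_nat X.property.1
  have hk : (k : ℕ∞) ≤ (max k N₀ : ℕ) := by exact_mod_cast le_max_left k N₀
  have hX₀ := hN₀ _ (le_max_right k N₀)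
  obtain ⟨y, hy⟩ := (bijective_incl_nat S hd hk).2
    (GrothGrp.cls (𝟭 _) (⟨X.obj, hX₀, X.property.2⟩ : (onProp S _).FullSubcategory))
  refine ⟨y, fun N hN hX => ?_⟩
  have h1 : ((max k N₀ : ℕ) : ℕ∞) ≤ (max (max k N₀) N : ℕ) := by
    exact_mod_cast le_max_left (max k N₀) N
  have h2 : (N : ℕ∞) ≤ (max (max k N₀) N : ℕ) := by exact_mod_cast le_max_right (max k N₀) N
  refine (bijective_incl_nat S (hd.trans (by exact_mod_cast hN)) h2).1 ?_
  rw [incl_incl, incl_cls, ← incl_incl S hk h1, hy, incl_cls]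

/-- The inverse of the map `K(R on S, k) → K(R on S, ∞)`. -/
noncomputable def ofTop {k : ℕ} (hd : d ≤ k) : KOn S ⊤ →+ KOn S k :=
  GrothGrp.lift (𝟭 _) (onProp S ⊤) (fun X => (exists_incl_eq_cls S hd X).choose)
    ⟨ModCx.zero, onProp_zero S ⊤⟩ ModCx.isZero_zero (fun _ => 0)
    (fun X' X X'' h => by
      obtain ⟨N₁, h₁⟩ := exists_isPerf_nat X'.property.1
      obtain ⟨N₂, h₂⟩ := exists_isPerf_nat X.property.1
      obtain ⟨N₃, h₃⟩ := exists_isPerf_nat X''.property.1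
      have hN : (k : ℕ∞) ≤ (k + N₁ + N₂ + N₃ : ℕ) := by exact_mod_cast (by omega)
      refine (bijective_incl_nat S hd hN).1 ?_
      rw [map_add, (exists_incl_eq_cls S hd X').choose_spec _ hN (h₁ _ (by omega)),
        (exists_incl_eq_cls S hd X).choose_spec _ hN (h₂ _ (by omega)),
        (exists_incl_eq_cls S hd X'').choose_spec _ hN (h₃ _ (by omega))]
      exact GrothGrp.cls_eq_add (U := 𝟭 _) h)
    (fun X h => by
      obtain ⟨N₁, h₁⟩ := exists_isPerf_nat X.property.1
      have hN : (k : ℕ∞) ≤ (k + N₁ : ℕ) := by exact_mod_cast (by omega)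
      refine (bijective_incl_nat S hd hN).1 ?_
      rw [map_zero, (exists_incl_eq_cls S hd X).choose_spec _ hN (h₁ _ (by omega))]
      exact GrothGrp.cls_eq_zero (U := 𝟭 _) h)

theorem bijective_incl_top {k : ℕ} (hd : d ≤ k) :
    Function.Bijective (incl S (le_top : (k : ℕ∞) ≤ ⊤)) := by
  have hc : ∀ X, ofTop S hd (GrothGrp.cls (𝟭 _) X) = (exists_incl_eq_cls S hd X).choose :=
    fun X => GrothGrp.lift_cls _ _ _ _ _ _ X
  have h1 : (ofTop S hd).comp (incl S le_top) = AddMonoidHom.id _ :=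
    GrothGrp.hom_ext _ _ fun X => by
      rw [AddMonoidHom.comp_apply, incl_cls, hc, AddMonoidHom.id_apply]
      have h2 := (exists_incl_eq_cls S hd
        ⟨X.obj, X.property.1.mono le_top, X.property.2⟩).choose_spec k le_rfl X.property.1
      rwa [incl_refl] at h2
  have h2 : (incl S le_top).comp (ofTop S hd) = AddMonoidHom.id _ :=
    GrothGrp.hom_ext _ _ fun X => by
      rw [AddMonoidHom.comp_apply, hc, AddMonoidHom.id_apply]
      obtain ⟨N₁, h₁⟩ := exists_isPerf_nat X.property.1
      have hN : (k : ℕ∞) ≤ (k + N₁ : ℕ) := by exact_mod_cast (by omega)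
      rw [← incl_incl S hN le_top,
        (exists_incl_eq_cls S hd X).choose_spec _ hN (h₁ _ (by omega)), incl_cls]
  exact Function.bijective_iff_has_inverse.2 ⟨ofTop S hd, DFunLike.congr_fun h1,
    DFunLike.congr_fun h2⟩

theorem bijective_incl {k n : ℕ∞} (h : k ≤ n) (hd : d ≤ k) : Function.Bijective (incl S h) := by
  induction k with
  | top =>
    obtain rfl := top_le_iff.1 h
    have : ⇑(incl S h) = id := funext (incl_refl S)
    rw [this]
    exact Function.bijective_id
  | coe k =>
    have hd' : d ≤ k := by exact_mod_cast hd
    induction n with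
    | top => exact bijective_incl_top S hd'
    | coe n => exact bijective_incl_nat S hd' h

end KOn

theorem theorem1p2 {R : Type u} [CommRing R] {d : ℕ} (S : Fin d → Submonoid R) :
    -- the main theorem: `K(R on S, k) → K(R on S, n)` is an isomorphism for `d ≤ k ≤ n ≤ ∞`
    (∀ (k n : ℕ∞) (h : k ≤ n), (d : ℕ∞) ≤ k → Function.Bijective (KOn.incl S h)) ∧
    -- (a) the maps `W : G(T_s, n + 1) → G(T_{s²}, n)` with `W i = j` and `i W = j`
    (∀ (s : Fin d → R) (n : ℕ∞), (d : ℕ∞) ≤ n →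
      ∃ W : GDG (TDGA s) (n + 1) →+ GDG (TDGA fun i => s i ^ 2) n,
        W.comp (GDG.incl (TDGA s) (le_self_add : n ≤ n + 1)) =
            GDG.res (TDGA.map (s := s) (t := s) fun i => (pow_two (s i)).symm) n ∧
          (GDG.incl (TDGA fun i => s i ^ 2) (le_self_add : n ≤ n + 1)).comp W =
            GDG.res (TDGA.map (s := s) (t := s) fun i => (pow_two (s i)).symm) (n + 1)) ∧
    -- (b) `colim_s G(T_s, n) → G(R on S, n)` is an isomorphism
    (∀ n : ℕ∞, (d : ℕ∞) ≤ n → IsIso (colimToKOn S n)) ∧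
    -- (c) `G(R on S, n) → G(R on S, n + 1)` is an isomorphism
    (∀ n : ℕ∞, (d : ℕ∞) ≤ n →
      Function.Bijective (KOn.incl S (le_self_add : n ≤ n + 1))) := by
  refine ⟨fun k n h hd => KOn.bijective_incl S h hd, fun s n hn => ?_,
    fun n _ => TMod.isIso_colimToKOn S n, fun n hn => KOn.bijective_incl_succ S hn⟩
  have hu : ∀ i, s i * s i = s i ^ 2 := fun i => (pow_two (s i)).symm
  exact ⟨TMod.W hu hn, TMod.W_comp_incl hu hn, TMod.incl_comp_W hu hn⟩
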